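/- Let $k\ge 2$ be an integer and $\Psi:\mathbb{N}\to\mathbb{R}_{>0}$, where $\mathbb{N}=\{1,2,\dots\}$. Let $\mathscr{K}_k(\Psi)$ be the set of all real $\zeta$, not algebraic of degree $\le k$, for which $$\max_{1\le j\le k}|\zeta^j q-p_j|\le\Psi(q)$$ holds for infinitely many $(q,p_1,\dots,p_k)\in\mathbb{N}\times\mathbb{Z}^k$, and let $\mathscr{K}_k^*(\Psi)$ be defined in the same way, but with only those vectors $(q,p_1,\dots,p_k)$ admitted whose coordinates are relatively prime (have greatest common divisor $1$). Assume $$\Psi(lx)\le l\,\Psi(x)\qquad\text{for all } l,x\in\mathbb{N}.\qquad (B)$$ (i) Suppose that there is $\hat x$ such that $\Psi(x)<\frac{1}{2x}$ for all $x\ge\hat x$. Then for every non-empty open interval $I\subseteq(-1/2,1/2)$ the set $$\Bigl(\mathscr{K}_k(\Psi)\setminus\bigcup_{c<1}\mathscr{K}_k(c\Psi)\Bigr)\cap I$$ is uncountable. (ii) For every non-empty open interval $J\subseteq\mathbb{R}$ there is an effective constant $d>0$, depending only on $J$, such that the following holds. If there is $\hat x$ such that $\Psi(x)<\frac{d}{x}$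 for all $x\ge\hat x$, then for every fixed $c_0<1$ the set $$\bigl(\mathscr{K}_k(\Psi)\setminus\mathscr{K}_k(c_0\Psi)\bigr)\cap J$$ is uncountable. Here "effective" means that $d$ can be taken as a computable positive rational function of the end points of any interval with rational end points that is contained in $J$. Both claims hold with $\mathscr{K}_k^*$ in place of $\mathscr{K}_k$, and for $\mathscr{K}_k^*$ the condition $(B)$ may be dropped. Elements of all these sets can be effectively determined. That is: there is one algorithm for (i) and one for (ii) which, given $k$, rational end points $a<b$ of an interval (contained in $(-1/2,1/2)$ in case (i)), a threshold $\hat x$ as above, in case (ii) also a rational $c_0\in[0,1)$, and as an oracle arbitrarily good rational approximations to the values of $\Psi$, compute arbitrarily good rational approximations to a real number $\zeta\in(a,b)$ which lies in the set of (i) with $I=(a,b)$, respectively of (ii) with $J=(a,b)$, for $\mathscr{K}_k^*$ and, if $(B)$ holds, also for $\mathscr{K}_k$. -/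

import Mathlib

open Set

namespace PowerApprox

/-- The real numbers that are not algebraic of degree at most `k`. -/
def nonAlgebraic (k : ℕ) : Set ℝ :=
  {ζ | ¬ (IsAlgebraic ℚ ζ ∧ (minpoly ℚ ζ).natDegree ≤ k)}

/-- The integer vectors `(q, p₁, …, p_k)` with `q ≥ 1` and `max_{1 ≤ j ≤ k} |ζ ^ j q - p_j| ≤ Ψ q`
(the coordinate `p_j` is stored at the index `j - 1` of `Fin k`). -/
def solutions (k : ℕ) (Ψ : ℕ → ℝ) (ζ : ℝ) : Set (ℕ × (Fin k → ℤ)) :=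
  {v | 1 ≤ v.1 ∧ ∀ j : Fin k, |ζ ^ ((j : ℕ) + 1) * (v.1 : ℝ) - (v.2 j : ℝ)| ≤ Ψ v.1}

/-- The vector `(q, p₁, …, p_k)` is relatively prime: its coordinates have no common divisor
except `1`. -/
def IsRelPrime {k : ℕ} (v : ℕ × (Fin k → ℤ)) : Prop :=
  ∀ d : ℕ, d ∣ v.1 → (∀ j, (d : ℤ) ∣ v.2 j) → d = 1

/-- The set `𝒦_k(Ψ)`. -/
def K (k : ℕ) (Ψ : ℕ → ℝ) : Set ℝ :=
  {ζ | ζ ∈ nonAlgebraic k ∧ (solutions k Ψ ζ).Infinite}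

/-- The set `𝒦_k*(Ψ)`: as `𝒦_k(Ψ)`, with relatively prime vectors only. -/
def KStar (k : ℕ) (Ψ : ℕ → ℝ) : Set ℝ :=
  {ζ | ζ ∈ nonAlgebraic k ∧ {v ∈ solutions k Ψ ζ | IsRelPrime v}.Infinite}

/-- `Ψ` is positive on the positive integers (the value at `0` is never used). -/
def Positive (Ψ : ℕ → ℝ) : Prop := ∀ x : ℕ, 1 ≤ x → 0 < Ψ x

/-- `Ψ(l x) ≤ l Ψ(x)` for all positive integers `l`, `x`. -/
def SubHomogeneous (Ψ : ℕ → ℝ) : Prop :=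
  ∀ l x : ℕ, 1 ≤ l → 1 ≤ x → Ψ (l * x) ≤ (l : ℝ) * Ψ x

/-- `Ψ(x) < d / x` for all positive integers `x ≥ X`. -/
def DecaysFrom (X : ℕ) (d : ℝ) (Ψ : ℕ → ℝ) : Prop :=
  ∀ x : ℕ, 1 ≤ x → X ≤ x → Ψ x < d / (x : ℝ)

/-- A non-empty open interval of the real line, bounded or not. -/
def IsOpenInterval (I : Set ℝ) : Prop := IsOpen I ∧ I.OrdConnected ∧ I.Nonempty

/-- The interval `(u / w, v / w)` with rational end points. -/
def ratInterval (u v : ℤ) (w : ℕ) : Set ℝ := Ioo ((u : ℝ) / (w : ℝ)) ((v : ℝ) / (w : ℝ))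

/-- `g` describes the real number `ζ` by dyadic approximations: `|ζ - g(n) / 2 ^ n| ≤ 2 ^ (-n)`. -/
def IsRealName (g : ℕ → ℤ) (ζ : ℝ) : Prop :=
  ∀ n : ℕ, |ζ - (g n : ℝ) / 2 ^ n| ≤ 1 / 2 ^ n

/-- `f` describes the function `Ψ` on the positive integers by dyadic approximations of its
(positive) values: `|Ψ(x) - f(⟨x, n⟩) / 2 ^ n| ≤ 2 ^ (-n)`. -/
def IsFunName (f : ℕ → ℕ) (Ψ : ℕ → ℝ) : Prop :=
  ∀ x : ℕ, 1 ≤ x → ∀ n : ℕ, |Ψ x - (f (Nat.pair x n) : ℝ) / 2 ^ n| ≤ 1 / 2 ^ n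

/-- `M` computes the sequence `g` from the oracle `f` and the finite input `i`. An oracle algorithm
is presented in the usual way by what it does on finite parts of the oracle: `M (σ, i, n)` is the
`n`-th output if the oracle values listed in `σ = [f 0, …, f (N - 1)]` are enough to find it, and
`none` if the algorithm has to see more. -/
def OracleComputes {ι : Type} (M : List ℕ × ι × ℕ → Option ℤ) (f : ℕ → ℕ) (i : ι)
    (g : ℕ → ℤ) : Prop :=
  ∀ n : ℕ, (∃ N : ℕ, M ((List.range N).map f, i, n) = some (g n)) ∧
    ∀ (N : ℕ) (m : ℤ), M ((List.range N).map f, i, n) = some m → m = g n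

end PowerApprox

/-! The number ζ is built as the limit of increasing fractions p_n / q_n with consecutive
determinants 1, so that ζ - p_n / q_n is about 1 / (q_n q_{n+1}). Let H be `height k (p n) (q n)`,
which is q_n^(k-1) times the largest absolute derivative of x, x^2, …, x^k at p_n / q_n. By first
order expansion, the largest error of the vector (q_n^k, p_n q_n^(k-1), …, p_n^k) is about H q_n (ζ
- p_n / q_n), that is, about H / q_{n+1}. Choosing q_{n+1} slightly above H / Ψ(q_n^k), with
relative excess between 1 / q_n and 10 / q_n, makes the error at most Ψ(q_n^k) eventually, yet
larger than c Ψ(q_n^k) for any fixed c < 1 and large n (`eventually_abs_pow_sub_le`,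
`eventually_lt_abs_pow_sub`). The denominators grow so fast that Liouville's inequality excludes
algebraic ζ of degree at most k.

No other vectors do better. If d is small in terms of a bound for |ζ|, every solution with large
first coordinate is a multiple of some (b^k, a b^(k-1), …, a^k) (`exists_eq_mul_pow`). Primitivity,
or else condition (B), reduces this to the multiplier 1. Then a / b is so close to ζ that it must be
one of the p_n / q_n (`one_div_le_abs_limit_sub`), where the lower bound applies
(`not_solution_of_large`).

At each step the partial quotient may be increased by 0 or 1. Different choices give different
limits, hence uncountably many ζ. Taking 0 throughout, and approximating Ψ(q_n^k) only to relative
precision 1 / (4 q_n), gives the algorithm. Both claims follow from this one construction, which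
removes all c < 1 at once; they differ only in the admissible d. -/

namespace PowerApprox

/-! ### Primitive recursive arithmetic of integers -/

section IntegerPrimrec

/-- Nonnegative integers have even codes and negative ones odd codes. Positive and negative parts
can thus be read off the code, which reduces integer arithmetic to that of natural numbers. -/
theorem encode_int (z : ℤ) :
    Encodable.encode z = if 0 ≤ z then 2 * z.toNat else 2 * (-z).toNat - 1 := by
  rcases z with n | n
  · change Equiv.intEquivNat (Int.ofNat n) = _
    rw [if_pos (show (0 : ℤ) ≤ Int.ofNat n from Int.natCast_nonneg n)]
    rfl
  · change Equiv.intEquivNat (Int.negSucc n) = _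
    have h : ¬ (0 : ℤ) ≤ Int.negSucc n := by omega
    rw [if_neg h]
    simp [Equiv.intEquivNat, Equiv.intEquivNatSumNat]
    omega

theorem primrec_int_toNat : Primrec Int.toNat := by
  have h : Primrec fun z : ℤ => if Encodable.encode z % 2 = 0 then Encodable.encode z / 2 else 0 :=
    Primrec.ite (Primrec.eq.comp (Primrec.nat_mod.comp Primrec.encode (Primrec.const 2))
      (Primrec.const 0)) (Primrec.nat_div.comp Primrec.encode (Primrec.const 2)) (Primrec.const 0)
  refine h.of_eq fun z => ?_
  rw [encode_int]
  split_ifs <;> omega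

theorem primrec_int_neg_toNat : Primrec fun z : ℤ => (-z).toNat := by
  have h : Primrec fun z : ℤ =>
      if Encodable.encode z % 2 = 0 then 0 else Encodable.encode z / 2 + 1 :=
    Primrec.ite (Primrec.eq.comp (Primrec.nat_mod.comp Primrec.encode (Primrec.const 2))
      (Primrec.const 0)) (Primrec.const 0)
      (Primrec.succ.comp (Primrec.nat_div.comp Primrec.encode (Primrec.const 2)))
  refine h.of_eq fun z => ?_
  rw [encode_int]
  split_ifs <;> omega

theorem primrec_int_natAbs : Primrec Int.natAbs :=
  (Primrec.nat_add.comp primrec_int_toNat primrec_int_neg_toNat).of_eq fun z => by omega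

theorem primrec_natCast_sub : Primrec₂ fun a b : ℕ => (a : ℤ) - b := by
  have h : Primrec fun x : ℕ × ℕ =>
      if x.2 ≤ x.1 then 2 * (x.1 - x.2) else 2 * (x.2 - x.1) - 1 :=
    Primrec.ite (Primrec.nat_le.comp Primrec.snd Primrec.fst)
      (Primrec.nat_mul.comp (Primrec.const 2) (Primrec.nat_sub.comp Primrec.fst Primrec.snd))
      (Primrec.pred.comp (Primrec.nat_mul.comp (Primrec.const 2)
        (Primrec.nat_sub.comp Primrec.snd Primrec.fst)))
  refine Primrec.encode_iff.1 (h.of_eq fun x => ?_)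
  beta_reduce
  rw [encode_int]
  split_ifs <;> omega

theorem primrec_int_sub : Primrec₂ fun a b : ℤ => a - b := by
  have h : Primrec fun x : ℤ × ℤ =>
      ((x.1.toNat + (-x.2).toNat : ℕ) : ℤ) - ((-x.1).toNat + x.2.toNat : ℕ) :=
    primrec_natCast_sub.comp
      (Primrec.nat_add.comp (primrec_int_toNat.comp Primrec.fst)
        (primrec_int_neg_toNat.comp Primrec.snd))
      (Primrec.nat_add.comp (primrec_int_neg_toNat.comp Primrec.fst)
        (primrec_int_toNat.comp Primrec.snd))
  exact h.of_eq fun x => by beta_reduce; omega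

theorem primrec_natCast_mul : Primrec₂ fun (a : ℕ) (b : ℤ) => (a : ℤ) * b := by
  have h : Primrec fun x : ℕ × ℤ =>
      ((x.1 * x.2.toNat : ℕ) : ℤ) - (x.1 * (-x.2).toNat : ℕ) :=
    primrec_natCast_sub.comp
      (Primrec.nat_mul.comp Primrec.fst (primrec_int_toNat.comp Primrec.snd))
      (Primrec.nat_mul.comp Primrec.fst (primrec_int_neg_toNat.comp Primrec.snd))
  refine h.of_eq fun x => ?_
  have : x.2 = (x.2.toNat : ℤ) - ((-x.2).toNat : ℤ) := by omega
  conv_rhs => rw [this]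
  push_cast
  ring

theorem primrec_natCast : Primrec fun a : ℕ => (a : ℤ) :=
  (primrec_natCast_sub.comp Primrec.id (Primrec.const 0)).of_eq fun a => by simp

theorem primrec_nat_pow : Primrec₂ fun a b : ℕ => a ^ b :=
  Primrec₂.unpaired'.1 Nat.Primrec.pow

end IntegerPrimrec

/-! ### The recursion and the algorithm -/

/-- Two neighbouring fractions `r / s < p / q`, stored as `((r, s), (p, q))`. -/
abbrev State := (ℤ × ℕ) × (ℤ × ℕ)

/-- The largest of the integers `(j + 1) * |p| ^ j * q ^ (k - 1 - j)` for `j < k`. -/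
def height (k : ℕ) (p : ℤ) (q : ℕ) : ℕ :=
  (Finset.range k).sup fun j => (j + 1) * p.natAbs ^ j * q ^ (k - 1 - j)

/-- The partial quotient that follows a state when `F / 2 ^ m` is an approximation to the
prescribed quality and `e` is a free parameter. -/
def multiplier (k F m e : ℕ) (z : State) : ℕ :=
  height k z.2.1 z.2.2 * 2 ^ m * (z.2.2 + 2) / (F * z.2.2 ^ 2) + 2 + z.1.2 + e

/-- The state that follows a given one. -/
def advance (k F m e : ℕ) (z : State) : State :=
  (z.2, (multiplier k F m e z * z.2.1 - z.1.1, multiplier k F m e z * z.2.2 - z.1.2))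

/-- The initial state; its second fraction is `u / w + 1 / (w ^ 2 * (X + 3))`. -/
def start (X : ℕ) (u : ℤ) (w : ℕ) : State :=
  ((u.natAbs + 1 + (X + 3) * (w * (u.natAbs + 1) - u).toNat * u,
    w * (X + 3) * (w * (u.natAbs + 1) - u).toNat + 1),
   (w * (X + 3) * u + 1, w ^ 2 * (X + 3)))

/-- The least index `m` such that the entry of `σ` at `Nat.pair b m` is at least `t`
(the length of `σ` if there is none). -/
def findLevel (σ : List ℕ) (b t : ℕ) : ℕ :=
  (List.range σ.length).findIdx fun m => decide (t ≤ σ.getD (Nat.pair b m) 0)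

/-- The state that follows a given one, computed from a finite part of the oracle. -/
def advance? (σ : List ℕ) (k : ℕ) (z : State) : Option State :=
  if findLevel σ (z.2.2 ^ k) (4 * z.2.2) < σ.length then
    some (advance k (σ.getD (Nat.pair (z.2.2 ^ k) (findLevel σ (z.2.2 ^ k) (4 * z.2.2))) 0)
      (findLevel σ (z.2.2 ^ k) (4 * z.2.2)) 0 z)
  else none

/-- The `n`-th state, computed from a finite part of the oracle. -/
def run (σ : List ℕ) (k X : ℕ) (u : ℤ) (w n : ℕ) : Option State :=
  Nat.rec (some (start X u w)) (fun _ o => o.bind (advance? σ k)) n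

/-- An integer near to `2 ^ n * (p / q)`. -/
def dyadicRound (p : ℤ) (q n : ℕ) : ℤ :=
  (((2 * p.toNat * 2 ^ n + q) / (2 * q) : ℕ) : ℤ) - ((2 * (-p).toNat * 2 ^ n + q) / (2 * q) : ℕ)

/-- The algorithm: dyadic approximations to the limit of the fractions in the states. -/
def algorithm (x : List ℕ × (ℕ × ℕ × ℤ × ℤ × ℕ) × ℕ) : Option ℤ :=
  (run x.1 x.2.1.1 x.2.1.2.1 x.2.1.2.2.1 x.2.1.2.2.2.2 x.2.2).map
    fun z => dyadicRound z.2.1 z.2.2 x.2.2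

/-! ### The algorithm is primitive recursive -/

section Computability

variable {α : Type*} [Primcodable α]

theorem primrec_height : Primrec fun x : ℕ × ℤ × ℕ => height x.1 x.2.1 x.2.2 := by
  have h : Primrec fun x : ℕ × ℤ × ℕ => (Nat.rec 0
      (fun j y => max y ((j + 1) * x.2.1.natAbs ^ j * x.2.2 ^ (x.1 - 1 - j))) x.1 : ℕ) := by
    refine Primrec.nat_rec' Primrec.fst (Primrec.const 0) (Primrec.to₂ (Primrec.nat_max.comp
      (Primrec.snd.comp Primrec.snd) (Primrec.nat_mul.comp (Primrec.nat_mul.comp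
        (Primrec.succ.comp (Primrec.fst.comp Primrec.snd))
        (primrec_nat_pow.comp (primrec_int_natAbs.comp
          (Primrec.fst.comp (Primrec.snd.comp Primrec.fst))) (Primrec.fst.comp Primrec.snd)))
        (primrec_nat_pow.comp (Primrec.snd.comp (Primrec.snd.comp Primrec.fst))
          (Primrec.nat_sub.comp (Primrec.pred.comp (Primrec.fst.comp Primrec.fst))
            (Primrec.fst.comp Primrec.snd))))))
  refine h.of_eq fun x => ?_
  have aux : ∀ (g : ℕ → ℕ) (n : ℕ), (Nat.rec 0 (fun j y => max y (g j)) n : ℕ) =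
      (Finset.range n).sup g := by
    intro g n
    induction n with
    | zero => simp
    | succ n ih =>
      rw [Finset.range_add_one, Finset.sup_insert, ← ih, max_comm]
  exact aux _ _

theorem primrec_multiplier {k F m e : α → ℕ} {z : α → State} (hk : Primrec k) (hF : Primrec F)
    (hm : Primrec m) (he : Primrec e) (hz : Primrec z) :
    Primrec fun x => multiplier (k x) (F x) (m x) (e x) (z x) := by
  have hp := Primrec.fst.comp (Primrec.snd.comp hz)
  have hq := Primrec.snd.comp (Primrec.snd.comp hz)
  have hs := Primrec.snd.comp (Primrec.fst.comp hz)
  exact Primrec.nat_add.comp (Primrec.nat_add.comp (Primrec.nat_add.comp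
    (Primrec.nat_div.comp
      (Primrec.nat_mul.comp (Primrec.nat_mul.comp
        (primrec_height.comp (Primrec.pair hk (Primrec.pair hp hq)))
        (primrec_nat_pow.comp (Primrec.const 2) hm))
        (Primrec.nat_add.comp hq (Primrec.const 2)))
      (Primrec.nat_mul.comp hF (primrec_nat_pow.comp hq (Primrec.const 2))))
    (Primrec.const 2)) hs) he

theorem primrec_advance {k F m e : α → ℕ} {z : α → State} (hk : Primrec k) (hF : Primrec F)
    (hm : Primrec m) (he : Primrec e) (hz : Primrec z) :
    Primrec fun x => advance (k x) (F x) (m x) (e x) (z x) := by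
  have hA := primrec_multiplier hk hF hm he hz
  exact Primrec.pair (Primrec.snd.comp hz) (Primrec.pair
    (primrec_int_sub.comp (primrec_natCast_mul.comp hA (Primrec.fst.comp (Primrec.snd.comp hz)))
      (Primrec.fst.comp (Primrec.fst.comp hz)))
    (Primrec.nat_sub.comp (Primrec.nat_mul.comp hA (Primrec.snd.comp (Primrec.snd.comp hz)))
      (Primrec.snd.comp (Primrec.fst.comp hz))))

theorem primrec_int_add : Primrec₂ fun a b : ℤ => a + b :=
  (primrec_int_sub.comp Primrec.fst (primrec_int_sub.comp (Primrec.const 0) Primrec.snd)).of_eq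
    fun x => by beta_reduce; omega

theorem primrec_start {X w : α → ℕ} {u : α → ℤ} (hX : Primrec X) (hu : Primrec u)
    (hw : Primrec w) : Primrec fun x => start (X x) (u x) (w x) := by
  have ht := Primrec.nat_add.comp hX (Primrec.const 3)
  have hl := Primrec.succ.comp (primrec_int_natAbs.comp hu)
  have hy := primrec_int_toNat.comp (primrec_int_sub.comp
    (primrec_natCast.comp (Primrec.nat_mul.comp hw hl)) hu)
  have h := Primrec.pair
    (Primrec.pair
      (primrec_int_add.comp (primrec_natCast.comp hl)
        (primrec_natCast_mul.comp (Primrec.nat_mul.comp ht hy) hu))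
      (Primrec.succ.comp (Primrec.nat_mul.comp (Primrec.nat_mul.comp hw ht) hy)))
    (Primrec.pair
      (primrec_int_add.comp (primrec_natCast_mul.comp (Primrec.nat_mul.comp hw ht) hu)
        (Primrec.const 1))
      (Primrec.nat_mul.comp (primrec_nat_pow.comp hw (Primrec.const 2)) ht))
  refine h.of_eq fun x => ?_
  simp [start]

theorem primrec_findLevel {σ : α → List ℕ} {b t : α → ℕ} (hσ : Primrec σ) (hb : Primrec b)
    (ht : Primrec t) : Primrec fun x => findLevel (σ x) (b x) (t x) := by
  refine Primrec.list_findIdx (Primrec.list_range.comp (Primrec.list_length.comp hσ))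
    (PrimrecRel.decide (PrimrecRel.comp (R := fun a b : ℕ => a ≤ b) Primrec.nat_le
      (ht.comp Primrec.fst) ((Primrec.list_getD 0).comp (hσ.comp Primrec.fst)
        (Primrec₂.natPair.comp (hb.comp Primrec.fst) Primrec.snd))))

theorem primrec_advance? : Primrec fun x : (List ℕ × ℕ) × State => advance? x.1.1 x.1.2 x.2 := by
  have hσ : Primrec fun x : (List ℕ × ℕ) × State => x.1.1 := Primrec.fst.comp Primrec.fst
  have hk : Primrec fun x : (List ℕ × ℕ) × State => x.1.2 := Primrec.snd.comp Primrec.fst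
  have hq : Primrec fun x : (List ℕ × ℕ) × State => x.2.2.2 :=
    Primrec.snd.comp (Primrec.snd.comp Primrec.snd)
  have hqk := primrec_nat_pow.comp hq hk
  have hm := primrec_findLevel hσ hqk (Primrec.nat_mul.comp (Primrec.const 4) hq)
  exact Primrec.ite (Primrec.nat_lt.comp hm (Primrec.list_length.comp hσ))
    (Primrec.option_some.comp (primrec_advance hk
      ((Primrec.list_getD 0).comp hσ (Primrec₂.natPair.comp hqk hm)) hm (Primrec.const 0)
      Primrec.snd)) (Primrec.const none)

theorem primrec_run {σ : α → List ℕ} {k X w n : α → ℕ} {u : α → ℤ} (hσ : Primrec σ)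
    (hk : Primrec k) (hX : Primrec X) (hu : Primrec u) (hw : Primrec w) (hn : Primrec n) :
    Primrec fun x => run (σ x) (k x) (X x) (u x) (w x) (n x) :=
  Primrec.nat_rec' hn (Primrec.option_some.comp (primrec_start hX hu hw))
    (Primrec.to₂ (Primrec.option_bind (Primrec.snd.comp Primrec.snd)
      (Primrec.to₂ (primrec_advance?.comp (Primrec.pair (Primrec.pair
        (hσ.comp (Primrec.fst.comp Primrec.fst)) (hk.comp (Primrec.fst.comp Primrec.fst)))
        Primrec.snd)))))

theorem primrec_dyadicRound {p : α → ℤ} {q n : α → ℕ} (hp : Primrec p) (hq : Primrec q)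
    (hn : Primrec n) : Primrec fun x => dyadicRound (p x) (q x) (n x) := by
  have h : ∀ {a : α → ℕ}, Primrec a →
      Primrec fun x => (2 * a x * 2 ^ n x + q x) / (2 * q x) := fun ha =>
    Primrec.nat_div.comp (Primrec.nat_add.comp (Primrec.nat_mul.comp
      (Primrec.nat_mul.comp (Primrec.const 2) ha) (primrec_nat_pow.comp (Primrec.const 2) hn)) hq)
      (Primrec.nat_mul.comp (Primrec.const 2) hq)
  exact primrec_natCast_sub.comp (h (primrec_int_toNat.comp hp))
    (h (primrec_int_neg_toNat.comp hp))

theorem primrec_algorithm : Primrec algorithm := by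
  have hi : Primrec fun x : List ℕ × (ℕ × ℕ × ℤ × ℤ × ℕ) × ℕ => x.2.1 :=
    Primrec.fst.comp Primrec.snd
  have hn : Primrec fun x : List ℕ × (ℕ × ℕ × ℤ × ℤ × ℕ) × ℕ => x.2.2 :=
    Primrec.snd.comp Primrec.snd
  have hz := primrec_run Primrec.fst (Primrec.fst.comp hi)
    (Primrec.fst.comp (Primrec.snd.comp hi))
    (Primrec.fst.comp (Primrec.snd.comp (Primrec.snd.comp hi)))
    (Primrec.snd.comp (Primrec.snd.comp (Primrec.snd.comp (Primrec.snd.comp hi)))) hn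
  exact Primrec.option_map hz (primrec_dyadicRound
    (Primrec.fst.comp (Primrec.snd.comp Primrec.snd))
    (Primrec.snd.comp (Primrec.snd.comp Primrec.snd)) (hn.comp Primrec.fst))

end Computability

/-! ### First order expansion of powers -/

section Powers

/-- Induction on the exponent: multiplying the expansion by y and replacing one factor y by x + (y -
x) creates just one further quadratic term. -/
theorem exists_abs_pow_sub_le (B : ℝ) (hB : 0 ≤ B) (j : ℕ) : ∃ C : ℝ, 0 ≤ C ∧
    ∀ x y : ℝ, |x| ≤ B → |y| ≤ B →
      |y ^ (j + 1) - x ^ (j + 1) - (j + 1) * x ^ j * (y - x)| ≤ C * (y - x) ^ 2 := by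
  induction j with
  | zero => exact ⟨0, le_rfl, fun x y _ _ => by simp⟩
  | succ j ih =>
    obtain ⟨C, hC, h⟩ := ih
    refine ⟨B * C + (j + 1) * B ^ j, by positivity, fun x y hx hy => ?_⟩
    have e : y ^ (j + 1 + 1) - x ^ (j + 1 + 1) - ((j + 1 : ℕ) + 1) * x ^ (j + 1) * (y - x) =
        y * (y ^ (j + 1) - x ^ (j + 1) - (j + 1) * x ^ j * (y - x)) +
          (j + 1) * x ^ j * (y - x) ^ 2 := by
      push_cast
      ring
    rw [e]
    refine (abs_add_le _ _).trans ?_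
    rw [add_mul (B * C), abs_mul, abs_mul (_ * _), abs_mul, abs_pow x,
      abs_of_nonneg (sq_nonneg (y - x)),
      abs_of_nonneg (by positivity : (0 : ℝ) ≤ (j : ℝ) + 1)]
    refine add_le_add ?_ ?_
    · rw [mul_assoc B C]
      exact mul_le_mul hy (h x y hx hy) (abs_nonneg _) hB
    · gcongr

theorem exists_abs_pow_sub_le_uniform (B : ℝ) (hB : 0 ≤ B) (k : ℕ) : ∃ C : ℝ, 0 ≤ C ∧
    ∀ j < k, ∀ x y : ℝ, |x| ≤ B → |y| ≤ B →
      |y ^ (j + 1) - x ^ (j + 1) - (j + 1) * x ^ j * (y - x)| ≤ C * (y - x) ^ 2 := by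
  choose C hC h using exists_abs_pow_sub_le B hB
  refine ⟨∑ j ∈ Finset.range k, C j, Finset.sum_nonneg fun j _ => hC j,
    fun j hj x y hx hy => (h j x y hx hy).trans ?_⟩
  exact mul_le_mul_of_nonneg_right
    (Finset.single_le_sum (fun i _ => hC i) (Finset.mem_range.2 hj)) (sq_nonneg _)

end Powers

/-! ### The height and chains of fractions -/

/-- Each entry of the maximum is q^(k-1) times the absolute derivative of x^(j+1) at p / q. This
links the integer `height` to the expansion of powers. -/
theorem height_eq_scaled {k j : ℕ} (hj : j < k) (p : ℤ) {q : ℕ} (hq : 0 < q) :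
    (((j + 1) * p.natAbs ^ j * q ^ (k - 1 - j) : ℕ) : ℝ) =
      (j + 1) * |(p : ℝ) / q| ^ j * q ^ (k - 1) := by
  have hq' : (q : ℝ) ≠ 0 := by positivity
  have e : (q : ℝ) ^ (k - 1) = q ^ j * q ^ (k - 1 - j) := by
    rw [← pow_add]
    congr 1
    omega
  rw [e, abs_div, Nat.abs_cast, div_pow]
  push_cast
  rw [Nat.cast_natAbs, Int.cast_abs]
  field_simp

theorem le_height {k j : ℕ} (hj : j < k) (p : ℤ) {q : ℕ} (hq : 0 < q) :
    (j + 1) * |(p : ℝ) / q| ^ j * q ^ (k - 1) ≤ height k p q := by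
  rw [← height_eq_scaled hj p hq]
  exact_mod_cast Finset.le_sup (f := fun j => (j + 1) * p.natAbs ^ j * q ^ (k - 1 - j))
    (Finset.mem_range.2 hj)

theorem exists_height_eq {k : ℕ} (hk : 0 < k) (p : ℤ) {q : ℕ} (hq : 0 < q) :
    ∃ j < k, (height k p q : ℝ) = (j + 1) * |(p : ℝ) / q| ^ j * q ^ (k - 1) := by
  obtain ⟨j, hj, e⟩ := Finset.exists_mem_eq_sup (Finset.range k)
    (Finset.nonempty_range_iff.2 hk.ne') fun j => (j + 1) * p.natAbs ^ j * q ^ (k - 1 - j)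
  rw [Finset.mem_range] at hj
  exact ⟨j, hj, by rw [← height_eq_scaled hj p hq, height, e]⟩

theorem pow_le_height {k : ℕ} (hk : 0 < k) (p : ℤ) {q : ℕ} (hq : 0 < q) :
    (q : ℝ) ^ (k - 1) ≤ height k p q := by
  simpa using le_height hk p hq

/-- A sequence of fractions `p n / q n` with consecutive determinants `1` and with denominators
that follow the rule `q (n + 1) ≈ height k (p n) (q n) / Ψ (q n ^ k)`. -/
structure Chain (k : ℕ) (Ψ : ℕ → ℝ) (p : ℕ → ℤ) (q : ℕ → ℕ) : Prop where
  two_le_k : 2 ≤ k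
  det : ∀ n, p (n + 1) * q n - p n * q (n + 1) = 1
  two_le_zero : 2 ≤ q 0
  pos : ∀ n, 0 < Ψ (q n ^ k)
  small : ∀ n, Ψ (q n ^ k) * q n ^ k ≤ 1 / 2
  lower : ∀ n, (1 + 1 / (q n : ℝ)) * (height k (p n) (q n) / Ψ (q n ^ k)) ≤ q (n + 1)
  upper : ∀ n, 1 ≤ n →
    (q (n + 1) : ℝ) ≤ (1 + 10 / (q n : ℝ)) * (height k (p n) (q n) / Ψ (q n ^ k))

/-- The limit of an increasing sequence of fractions. -/
noncomputable def limit (p : ℕ → ℤ) (q : ℕ → ℕ) : ℝ := ⨆ n, (p n : ℝ) / q n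

/-- The height is at least its entry q^(k-1) for j = 0, and 1 / Ψ(q^k) is at least 2 q^k. This is
the source of the rapid growth of the denominators. -/
theorem pow_le_ratio {k : ℕ} (hk : 2 ≤ k) {Ψ : ℕ → ℝ} (p : ℤ) {q : ℕ} (hq : 0 < q)
    (hp : 0 < Ψ (q ^ k)) (hs : Ψ (q ^ k) * q ^ k ≤ 1 / 2) :
    2 * (q : ℝ) ^ (k - 1) * q ^ k ≤ height k p q / Ψ (q ^ k) := by
  rw [le_div_iff₀ hp]
  have h := pow_le_height (by omega : 0 < k) p hq
  have : (0 : ℝ) ≤ (q : ℝ) ^ (k - 1) := by positivity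
  nlinarith

/-! ### Convergence, quality of approximation and transcendence of degree above k -/

namespace Chain

variable {k : ℕ} {Ψ : ℕ → ℝ} {p : ℕ → ℤ} {q : ℕ → ℕ} (c : Chain k Ψ p q)

include c

theorem two_le_and (n : ℕ) : 2 ≤ q n ∧ 2 * q n ^ (k - 1) * q n ^ k ≤ q (n + 1) := by
  have key : ∀ n, 2 ≤ q n → 2 * q n ^ (k - 1) * q n ^ k ≤ q (n + 1) := by
    intro n hn
    have h := pow_le_ratio c.two_le_k (p n) (by omega : 0 < q n) (c.pos n) (c.small n)
    have h1 := c.lower n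
    have h2 : (0 : ℝ) ≤ 1 / (q n : ℝ) := by positivity
    have h3 : (0 : ℝ) ≤ 2 * (q n : ℝ) ^ (k - 1) * q n ^ k := by positivity
    have : (2 * (q n : ℝ) ^ (k - 1) * q n ^ k) ≤ q (n + 1) := by nlinarith
    exact_mod_cast this
  induction n with
  | zero => exact ⟨c.two_le_zero, key 0 c.two_le_zero⟩
  | succ n ih =>
    have : 2 ≤ q (n + 1) := by
      refine le_trans ?_ ih.2
      have := Nat.mul_pos (Nat.pow_pos (n := k - 1) (by omega : 0 < q n))
        (Nat.pow_pos (n := k) (by omega : 0 < q n))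
      nlinarith
    exact ⟨this, key _ this⟩

theorem two_le (n : ℕ) : 2 ≤ q n := (c.two_le_and n).1

theorem q_pos (n : ℕ) : (0 : ℝ) < q n := by
  have := c.two_le n
  positivity

theorem two_le_cast (n : ℕ) : (2 : ℝ) ≤ q n := by exact_mod_cast c.two_le n

theorem cube_le (n : ℕ) : 2 * q n ^ 3 ≤ q (n + 1) := by
  refine le_trans ?_ (c.two_le_and n).2
  have h2 := c.two_le_k
  have h := c.two_le n
  rw [mul_assoc, ← pow_add]
  exact Nat.mul_le_mul_left _ (Nat.pow_le_pow_right (by omega) (by omega))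

theorem cube_le_cast (n : ℕ) : 2 * (q n : ℝ) ^ 3 ≤ q (n + 1) := by
  exact_mod_cast c.cube_le n

theorem four_mul_le (n : ℕ) : 4 * q n ≤ q (n + 1) := by
  have h := c.cube_le n
  have h2 := c.two_le n
  have h4 : 2 * 2 ≤ q n * q n := Nat.mul_le_mul h2 h2
  nlinarith

theorem four_mul_le_cast (n : ℕ) : 4 * (q n : ℝ) ≤ q (n + 1) := by
  exact_mod_cast c.four_mul_le n

theorem q_strictMono : StrictMono q := strictMono_nat_of_lt_succ fun n => by
  have h := c.four_mul_le n
  have h2 := c.two_le n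
  omega

theorem two_pow_le (n : ℕ) : 2 ^ (n + 1) ≤ q n := by
  induction n with
  | zero => simpa using c.two_le 0
  | succ n ih =>
    have := c.four_mul_le n
    rw [pow_succ]
    omega

theorem exists_le_q (B : ℝ) : ∃ N, ∀ n ≥ N, B ≤ q n := by
  obtain ⟨N, hN⟩ := exists_nat_ge B
  refine ⟨N, fun n hn => hN.trans ?_⟩
  exact_mod_cast hn.trans c.q_strictMono.le_apply

theorem frac_succ (n : ℕ) :
    (p (n + 1) : ℝ) / q (n + 1) = p n / q n + 1 / (q n * q (n + 1)) := by
  have h : (p (n + 1) : ℝ) * q n - p n * q (n + 1) = 1 := by exact_mod_cast c.det n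
  have h1 := c.q_pos n
  have h2 := c.q_pos (n + 1)
  field_simp
  linarith

theorem frac_lt_succ (n : ℕ) : (p n : ℝ) / q n < p (n + 1) / q (n + 1) := by
  rw [c.frac_succ]
  have h1 := c.q_pos n
  have h2 := c.q_pos (n + 1)
  have : 0 < 1 / ((q n : ℝ) * q (n + 1)) := by positivity
  linarith

theorem frac_mono : Monotone fun n => (p n : ℝ) / q n :=
  monotone_nat_of_le_succ fun n => (c.frac_lt_succ n).le

/-- The intervals from p_n / q_n to p_n / q_n + 1 / q_n^2 are nested because q_{n+1} ≥ 4 q_n. Every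
later fraction, and so the limit, stays inside them. -/
theorem upper_anti : Antitone fun n => (p n : ℝ) / q n + 1 / (q n : ℝ) ^ 2 := by
  refine antitone_nat_of_succ_le fun n => ?_
  rw [c.frac_succ]
  have h1 := c.q_pos n
  have h4 := c.four_mul_le_cast n
  have e1 : 1 / ((q n : ℝ) * q (n + 1)) ≤ 1 / (q n * (4 * q n)) := by gcongr
  have e2 : 1 / (q (n + 1) : ℝ) ^ 2 ≤ 1 / (4 * q n) ^ 2 := by gcongr
  have e3 : 1 / ((q n : ℝ) * (4 * q n)) + 1 / (4 * (q n : ℝ)) ^ 2 ≤ 1 / (q n : ℝ) ^ 2 := by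
    field_simp
    norm_num
  linarith

theorem frac_le_upper (m n : ℕ) : (p m : ℝ) / q m ≤ p n / q n + 1 / (q n : ℝ) ^ 2 := by
  have h1 : (0 : ℝ) < 1 / (q (max m n) : ℝ) ^ 2 := by
    have := c.q_pos (max m n)
    positivity
  have h2 := c.frac_mono (le_max_left m n)
  have h3 := c.upper_anti (le_max_right m n)
  simp only at h2 h3
  linarith

theorem frac_lt_limit (n : ℕ) : (p n : ℝ) / q n < limit p q :=
  (c.frac_lt_succ n).trans_le (le_ciSup (f := fun n => (p n : ℝ) / q n)
    ⟨_, by rintro _ ⟨m, rfl⟩; exact c.frac_le_upper m 0⟩ (n + 1))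

theorem limit_le (n : ℕ) : limit p q ≤ p n / q n + 1 / (q n : ℝ) ^ 2 :=
  ciSup_le fun m => c.frac_le_upper m n

theorem lt_limit_sub (n : ℕ) : 1 / ((q n : ℝ) * q (n + 1)) < limit p q - p n / q n := by
  have := c.frac_lt_limit (n + 1)
  rw [c.frac_succ] at this
  linarith

theorem limit_sub_le (n : ℕ) :
    limit p q - p n / q n ≤ 1 / ((q n : ℝ) * q (n + 1)) + 1 / (q (n + 1) : ℝ) ^ 2 := by
  have := c.limit_le (n + 1)
  rw [c.frac_succ] at this
  linarith

theorem limit_sub_le_two (n : ℕ) :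
    limit p q - p n / q n ≤ 2 / ((q n : ℝ) * q (n + 1)) := by
  have h1 := c.q_pos n
  have h2 := c.four_mul_le_cast n
  have h3 : (q n : ℝ) ≤ q (n + 1) := by linarith
  have h1' := c.q_pos (n + 1)
  have e : 1 / (q (n + 1) : ℝ) ^ 2 ≤ 1 / ((q n : ℝ) * q (n + 1)) := by
    rw [sq]
    gcongr
  have := c.limit_sub_le n
  calc _ ≤ _ := this
    _ ≤ 1 / ((q n : ℝ) * q (n + 1)) + 1 / ((q n : ℝ) * q (n + 1)) := by gcongr
    _ = _ := by ring

theorem ratio_pos (n : ℕ) : 0 < height k (p n) (q n) / Ψ (q n ^ k) := by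
  refine lt_of_lt_of_le ?_ (pow_le_ratio c.two_le_k (p n) (by have := c.two_le n; omega)
    (c.pos n) (c.small n))
  have := c.q_pos n
  positivity

theorem exists_pow_bound : ∃ C : ℝ, 0 ≤ C ∧ ∀ j < k, ∀ n,
    |limit p q ^ (j + 1) - ((p n : ℝ) / q n) ^ (j + 1) -
      (j + 1) * ((p n : ℝ) / q n) ^ j * (limit p q - p n / q n)| ≤
      C * (limit p q - p n / q n) ^ 2 := by
  obtain ⟨C, hC, h⟩ := exists_abs_pow_sub_le_uniform
    (max |(p 0 : ℝ) / q 0| |limit p q|) (by positivity) k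
  refine ⟨C, hC, fun j hj n => h j hj _ _ ?_ (le_max_right _ _)⟩
  exact abs_le_max_abs_abs (c.frac_mono (Nat.zero_le n)) (c.frac_lt_limit n).le

/-- `Ψ (q ^ k) / q ^ k` in terms of the scaled height. -/
theorem quality_eq (n : ℕ) : Ψ (q n ^ k) / (q n : ℝ) ^ k =
    height k (p n) (q n) / (q n : ℝ) ^ (k - 1) /
      (q n * (height k (p n) (q n) / Ψ (q n ^ k))) := by
  have h1 := c.q_pos n
  have h2 := c.pos n
  have h3 : (0 : ℝ) < height k (p n) (q n) :=
    lt_of_lt_of_le (by positivity) (pow_le_height (by have := c.two_le_k; omega) (p n)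
      (by have := c.two_le n; omega))
  have e : (q n : ℝ) ^ k = q n ^ (k - 1) * q n := by
    rw [← pow_succ]
    congr 1
    have := c.two_le_k
    omega
  rw [e]
  field_simp

theorem one_le_scaled (n : ℕ) : 1 ≤ height k (p n) (q n) / (q n : ℝ) ^ (k - 1) := by
  have h1 := c.q_pos n
  rw [le_div_iff₀ (by positivity), one_mul]
  exact pow_le_height (by have := c.two_le_k; omega) (p n) (by have := c.two_le n; omega)

/-- The margin 1 + 1 / q_n in `lower` absorbs both the tail of the sequence after index n + 1 and
the quadratic term of the expansion, which are of relative size O(1 / q_n^2). -/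
theorem eventually_abs_pow_sub_le : ∃ N, ∀ n ≥ N, ∀ j < k,
    |limit p q ^ (j + 1) - ((p n : ℝ) / q n) ^ (j + 1)| ≤ Ψ (q n ^ k) / (q n : ℝ) ^ k := by
  obtain ⟨C, hC, h⟩ := c.exists_pow_bound
  obtain ⟨N, hN⟩ := c.exists_le_q (1 + 2 * C)
  refine ⟨N, fun n hn j hj => ?_⟩
  have hb := h j hj n
  have hqC := hN n hn
  have h1 := c.q_pos n
  have h2 := c.two_le_cast n
  have hd0 := (c.lt_limit_sub n).le
  have hd1 := c.limit_sub_le n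
  have hd2 : limit p q - p n / q n ≤ 1 / (q n : ℝ) ^ 2 := by linarith [c.limit_le n]
  rw [c.quality_eq n]
  have hG := c.one_le_scaled n
  have hT := c.ratio_pos n
  have hlow := c.lower n
  have hjG : ((j : ℝ) + 1) * |(p n : ℝ) / q n| ^ j ≤
      height k (p n) (q n) / (q n : ℝ) ^ (k - 1) := by
    rw [le_div_iff₀ (by positivity)]
    exact le_height hj (p n) (by have := c.two_le n; omega)
  have hcube := c.cube_le_cast n
  have h1' := c.q_pos (n + 1)
  set G := (height k (p n) (q n) : ℝ) / (q n : ℝ) ^ (k - 1)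
  set T := (height k (p n) (q n) : ℝ) / Ψ (q n ^ k)
  set δ := limit p q - p n / q n
  set Q : ℝ := (q n : ℝ)
  set Q' : ℝ := (q (n + 1) : ℝ)
  have hδ : 0 ≤ δ := le_trans (by positivity) hd0
  have s1 : |limit p q ^ (j + 1) - ((p n : ℝ) / Q) ^ (j + 1)| ≤ G * δ * (1 + C * δ) := by
    have a1 : |(j + 1) * ((p n : ℝ) / Q) ^ j * δ| ≤ G * δ := by
      rw [abs_mul, abs_mul, abs_pow, abs_of_nonneg hδ,
        abs_of_nonneg (by positivity : (0 : ℝ) ≤ (j : ℝ) + 1)]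
      gcongr
    have a2 := abs_sub_abs_le_abs_sub (limit p q ^ (j + 1) - ((p n : ℝ) / Q) ^ (j + 1))
      ((j + 1) * ((p n : ℝ) / Q) ^ j * δ)
    have a3 : C * δ ^ 2 ≤ G * δ * (C * δ) := by
      have : 0 ≤ C * δ ^ 2 := by positivity
      nlinarith
    linarith
  refine s1.trans ?_
  rw [le_div_iff₀ (by positivity)]
  have s2 : T * (1 + 1 / Q) ≤ Q' := by linarith
  -- The tail contributes Q / Q', which is at most 1 / Q^2 since Q' ≥ 2 Q^3.
  have s3 : δ * Q * T * (1 + 1 / Q) ≤ 1 + 1 / Q ^ 2 := by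
    calc δ * Q * T * (1 + 1 / Q) = δ * Q * (T * (1 + 1 / Q)) := by ring
      _ ≤ (1 / (Q * Q') + 1 / Q' ^ 2) * Q * Q' := by gcongr
      _ = 1 + Q / Q' := by field_simp
      _ ≤ 1 + 1 / Q ^ 2 := by
        gcongr 1 + ?_
        rw [div_le_div_iff₀ h1' (by positivity)]
        nlinarith [pow_pos h1 3]
  have s4 : (1 + 1 / Q ^ 2) * (1 + C * δ) ≤ 1 + 1 / Q := by
    calc (1 + 1 / Q ^ 2) * (1 + C * δ) ≤ (1 + 1 / Q ^ 2) * (1 + C * (1 / Q ^ 2)) := by gcongr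
      _ = 1 + (1 + C) / Q ^ 2 + C / Q ^ 2 * (1 / Q ^ 2) := by field_simp; ring
      _ ≤ 1 + (1 + C) / Q ^ 2 + C / Q ^ 2 * 1 := by
        gcongr
        rw [div_le_one (by positivity)]
        nlinarith
      _ = 1 + (1 + 2 * C) / Q ^ 2 := by ring
      _ ≤ 1 + Q / Q ^ 2 := by gcongr
      _ = 1 + 1 / Q := by field_simp
  have s5 : δ * Q * T * (1 + C * δ) ≤ 1 := by
    have : δ * Q * T * (1 + C * δ) * (1 + 1 / Q) ≤ 1 * (1 + 1 / Q) := by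
      calc δ * Q * T * (1 + C * δ) * (1 + 1 / Q) =
          δ * Q * T * (1 + 1 / Q) * (1 + C * δ) := by ring
        _ ≤ (1 + 1 / Q ^ 2) * (1 + C * δ) := by gcongr
        _ ≤ _ := by linarith
    exact le_of_mul_le_mul_right this (by positivity)
  calc G * δ * (1 + C * δ) * (Q * T) = G * (δ * Q * T * (1 + C * δ)) := by ring
    _ ≤ G * 1 := by gcongr
    _ = G := mul_one G

/-- Here j is an index at which the height is attained, so that the linear term is exact. The
losses, 10 / q_n from `upper` and O(1 / q_n) from the quadratic term, are eventually smaller than 1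
- b. -/
theorem eventually_lt_abs_pow_sub {b : ℝ} (hb : b < 1) : ∃ N, ∀ n ≥ N, ∃ j < k,
    b * (Ψ (q n ^ k) / (q n : ℝ) ^ k) <
      |limit p q ^ (j + 1) - ((p n : ℝ) / q n) ^ (j + 1)| := by
  obtain ⟨C, hC, h⟩ := c.exists_pow_bound
  obtain ⟨N, hN⟩ := c.exists_le_q ((11 + C) / (1 - b))
  refine ⟨max N 1, fun n hn => ?_⟩
  have h1 := c.q_pos n
  obtain ⟨j, hj, e⟩ := exists_height_eq (by have := c.two_le_k; omega : 0 < k) (p n)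
    (by have := c.two_le n; omega : 0 < q n)
  refine ⟨j, hj, ?_⟩
  rcases lt_or_ge b 0 with hb0 | hb0
  · refine lt_of_lt_of_le ?_ (abs_nonneg _)
    have := c.pos n
    exact mul_neg_of_neg_of_pos hb0 (by positivity)
  have hbd := h j hj n
  have hqC := hN n ((le_max_left _ _).trans hn)
  rw [div_le_iff₀ (by linarith)] at hqC
  have h2 := c.two_le_cast n
  have hd0 := c.lt_limit_sub n
  have hd2 : limit p q - p n / q n ≤ 1 / (q n : ℝ) ^ 2 := by linarith [c.limit_le n]
  rw [c.quality_eq n]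
  have hG := c.one_le_scaled n
  have hT := c.ratio_pos n
  have hup := c.upper n ((le_max_right _ _).trans hn)
  have hjG : height k (p n) (q n) / (q n : ℝ) ^ (k - 1) =
      ((j : ℝ) + 1) * |(p n : ℝ) / q n| ^ j := by
    rw [e]
    field_simp
  have h1' := c.q_pos (n + 1)
  set G := (height k (p n) (q n) : ℝ) / (q n : ℝ) ^ (k - 1)
  set T := (height k (p n) (q n) : ℝ) / Ψ (q n ^ k)
  set δ := limit p q - p n / q n
  set Q : ℝ := (q n : ℝ)
  set Q' : ℝ := (q (n + 1) : ℝ)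
  have hδ : 0 < δ := lt_trans (by positivity) hd0
  have s1 : G * δ * (1 - C * δ) ≤ |limit p q ^ (j + 1) - ((p n : ℝ) / Q) ^ (j + 1)| := by
    have a1 : |(j + 1) * ((p n : ℝ) / Q) ^ j * δ| = G * δ := by
      rw [abs_mul, abs_mul, abs_pow, abs_of_pos hδ,
        abs_of_nonneg (by positivity : (0 : ℝ) ≤ (j : ℝ) + 1), hjG]
    have a2 := abs_sub_abs_le_abs_sub ((j + 1) * ((p n : ℝ) / Q) ^ j * δ)
      (limit p q ^ (j + 1) - ((p n : ℝ) / Q) ^ (j + 1))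
    rw [abs_sub_comm ((j + 1) * ((p n : ℝ) / Q) ^ j * δ)] at a2
    have a3 : C * δ ^ 2 ≤ G * δ * (C * δ) := by
      have : 0 ≤ C * δ ^ 2 := by positivity
      nlinarith
    linarith
  refine lt_of_lt_of_le ?_ s1
  rw [mul_div_assoc', div_lt_iff₀ (by positivity)]
  have s2 : 1 ≤ δ * Q * T * (1 + 10 / Q) := by
    calc (1 : ℝ) = 1 / (Q * Q') * Q * Q' := by field_simp
      _ ≤ δ * Q * ((1 + 10 / Q) * T) := by gcongr
      _ = _ := by ring
  have s3 : b * (1 + 10 / Q) < 1 - C * δ := by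
    have a1 : C * δ ≤ C / Q := by
      calc C * δ ≤ C * (1 / Q ^ 2) := by gcongr
        _ ≤ C * (1 / Q) := by
          gcongr
          nlinarith
        _ = C / Q := by ring
    have a2 : b * (1 + 10 / Q) + C / Q < 1 := by
      have : b * (1 + 10 / Q) + C / Q = (b * Q + 10 * b + C) / Q := by
        field_simp
      rw [this, div_lt_one h1]
      linarith
    linarith
  have hx : 0 < δ * Q * T := by positivity
  calc b * G ≤ b * G * (δ * Q * T * (1 + 10 / Q)) := le_mul_of_one_le_right (by positivity) s2
    _ = G * (δ * Q * T) * (b * (1 + 10 / Q)) := by ring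
    _ < G * (δ * Q * T) * (1 - C * δ) := by gcongr
    _ = G * δ * (1 - C * δ) * (Q * T) := by ring

theorem exists_between {b : ℕ} (hb : q 0 ≤ b) : ∃ n, q n ≤ b ∧ b < q (n + 1) := by
  have hex : ∃ n, b < q n := ⟨b + 1, lt_of_lt_of_le (Nat.lt_succ_self b) c.q_strictMono.le_apply⟩
  classical
  obtain ⟨n, hn⟩ : ∃ n, Nat.find hex = n + 1 := by
    refine Nat.exists_eq_succ_of_ne_zero fun h0 => ?_
    have := Nat.find_spec hex
    rw [h0] at this
    omega
  refine ⟨n, not_lt.1 (Nat.find_min hex (m := n) (by omega)), ?_⟩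
  have := Nat.find_spec hex
  rwa [hn] at this

omit c in
theorem one_div_le_abs_frac_sub {a p : ℤ} {b q : ℕ} (hb : 0 < b) (hq : 0 < q)
    (h : (a : ℝ) / b ≠ p / q) : 1 / ((b : ℝ) * q) ≤ |(a : ℝ) / b - p / q| := by
  have hb' : (0 : ℝ) < b := by positivity
  have hq' : (0 : ℝ) < q := by positivity
  have e : (a : ℝ) / b - p / q = ((a * q - p * b : ℤ) : ℝ) / (b * q) := by
    push_cast
    field_simp
  have hne : a * q - p * b ≠ 0 := by
    intro h0
    rw [h0, Int.cast_zero, zero_div, sub_eq_zero] at e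
    exact h e
  rw [e, abs_div, abs_of_pos (by positivity : (0 : ℝ) < b * q)]
  gcongr
  exact_mod_cast Int.one_le_abs hne

/-- For a suitable m, a / b differs from p_m / q_m by at least 1 / (b q_m), while the limit differs
from p_m / q_m by at most half of that. This needs q_{m+1} ≥ 4 b, and q_m ≤ 4 b turns the remainder
into a bound in b alone. -/
theorem one_div_le_abs_limit_sub {a : ℤ} {b : ℕ} (hb : q 0 ≤ b)
    (h : ∀ n, (a : ℝ) / b ≠ p n / q n) : 1 / (8 * (b : ℝ) ^ 2) ≤ |limit p q - a / b| := by
  obtain ⟨n, hn1, hn2⟩ := c.exists_between hb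
  have hb0 : 0 < b := lt_of_lt_of_le (by have := c.two_le 0; omega) hb
  have hbR : (0 : ℝ) < b := by positivity
  have key : ∀ m, 4 * (b : ℝ) ≤ q (m + 1) → (q m : ℝ) ≤ 4 * b →
      1 / (8 * (b : ℝ) ^ 2) ≤ |limit p q - a / b| := by
    intro m h1 h2
    have hm := c.q_pos m
    have hm' := c.two_le m
    have e1 := one_div_le_abs_frac_sub hb0 (by omega : 0 < q m) (h m)
    have e2 := c.limit_sub_le_two m
    have e3 := (c.frac_lt_limit m).le
    have e4 := abs_sub_abs_le_abs_sub ((a : ℝ) / b - p m / q m) (limit p q - p m / q m)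
    rw [sub_sub_sub_cancel_right, abs_sub_comm (a / b : ℝ) (limit p q),
      abs_of_nonneg (sub_nonneg.2 e3)] at e4
    have e5 : 2 / ((q m : ℝ) * q (m + 1)) ≤ 2 / (q m * (4 * b)) := by gcongr
    have e6 : 1 / ((b : ℝ) * q m) - 2 / (q m * (4 * b)) = 1 / (2 * b * q m) := by
      field_simp
      norm_num
    have e7 : 1 / (8 * (b : ℝ) ^ 2) ≤ 1 / (2 * b * q m) := by
      refine one_div_le_one_div_of_le (by positivity) ?_
      nlinarith
    linarith
  -- If q_{n+1} is below 4 b, the index n + 1 serves instead, because q_{n+2} ≥ 4 q_{n+1} > 4 b.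
  rcases le_total (4 * (b : ℝ)) (q (n + 1)) with h4 | h4
  · refine key n h4 ?_
    have : (q n : ℝ) ≤ b := by exact_mod_cast hn1
    linarith
  · refine key (n + 1) ?_ h4
    have h5 := c.four_mul_le_cast (n + 1)
    have : (b : ℝ) < q (n + 1) := by exact_mod_cast hn2
    linarith

theorem irrational_limit : Irrational (limit p q) := by
  rintro ⟨x, hx⟩
  obtain ⟨N, hN⟩ := c.exists_le_q (2 * x.den + 1)
  have hd : 0 < x.den := x.den_pos
  have h1 := c.frac_lt_limit N
  have h2 := c.limit_sub_le_two N
  have hxx : (x.num : ℝ) / x.den = limit p q := by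
    rw [← hx]
    exact_mod_cast x.num_div_den
  have h3 := one_div_le_abs_frac_sub (a := x.num) (p := p N) hd
    (by have := c.two_le N; omega : 0 < q N) (by rw [hxx]; exact h1.ne')
  rw [hxx, abs_of_pos (by linarith)] at h3
  have h4 := h3.trans h2
  have hq := c.q_pos N
  have hq' := c.q_pos (N + 1)
  have hdR : (0 : ℝ) < x.den := by positivity
  rw [div_le_div_iff₀ (by positivity) (by positivity)] at h4
  have h5 : (q N : ℝ) * q (N + 1) ≤ q N * (2 * x.den) := by linarith
  have h6 := le_of_mul_le_mul_left h5 hq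
  have h7 := hN (N + 1) (by omega)
  linarith

/-- Since q_{n+1} ≥ 2 q_n^(2k-1) and k ≥ 2, the distance to p_n / q_n is at most q_n^(-k-1). This
contradicts Liouville's inequality for an integer polynomial of degree at most k. -/
theorem limit_mem_nonAlgebraic : limit p q ∈ nonAlgebraic k := by
  rintro ⟨hal, hdeg⟩
  set f := IsLocalization.integerNormalization (nonZeroDivisors ℤ) (minpoly ℚ (limit p q))
    with hf
  have hf0 : f ≠ 0 := by
    rw [hf, Ne, IsFractionRing.integerNormalization_eq_zero_iff]
    exact minpoly.ne_zero hal.isIntegral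
  have hroot : Polynomial.eval (limit p q) (Polynomial.map (algebraMap ℤ ℝ) f) = 0 := by
    have := IsLocalization.integerNormalization_aeval_eq_zero (nonZeroDivisors ℤ)
      (minpoly ℚ (limit p q)) (minpoly.aeval ℚ (limit p q))
    rwa [Polynomial.aeval_def, Polynomial.eval₂_eq_eval_map] at this
  have hfdeg : f.natDegree ≤ k := by
    refine le_trans ?_ hdeg
    exact Polynomial.natDegree_le_natDegree (Polynomial.degree_mono
      (IsLocalization.integerNormalization_support _ _))
  obtain ⟨A, hA, h⟩ := Liouville.exists_pos_real_of_irrational_root c.irrational_limit hf0 hroot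
  obtain ⟨N, hN⟩ := c.exists_le_q (A + 1)
  -- Liouville's inequality is stated for denominators of the form b + 1.
  have h1 := h (p N) (q N - 1)
  have hq := c.q_pos N
  have hq2 := c.two_le N
  have hq2R := c.two_le_cast N
  have e : ((q N - 1 : ℕ) : ℝ) + 1 = q N := by
    rw [Nat.cast_sub (by omega)]
    push_cast
    ring
  rw [e, abs_of_pos (sub_pos.2 (c.frac_lt_limit N))] at h1
  have h2 := c.limit_sub_le_two N
  have h3 : 2 * (q N : ℝ) ^ (k - 1) * q N ^ k ≤ q (N + 1) := by
    exact_mod_cast (c.two_le_and N).2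
  have hk := c.two_le_k
  have h4 : (q N : ℝ) ≤ q N ^ (k - 1) := le_self_pow₀ (by linarith) (by omega)
  have h5 : (q N : ℝ) ^ f.natDegree ≤ q N ^ k := pow_le_pow_right₀ (by linarith) hfdeg
  have h6 : limit p q - p N / q N ≤ 1 / (q N * q N ^ k) := by
    refine h2.trans ?_
    rw [div_le_div_iff₀ (by have := c.q_pos (N + 1); positivity) (by positivity)]
    have h7 : 2 * (q N : ℝ) * q N ^ k ≤ q (N + 1) :=
      le_trans (by gcongr) h3
    nlinarith
  have h7 : (1 : ℝ) ≤ q N ^ k * (1 / (q N * q N ^ k) * A) := by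
    refine h1.trans ?_
    have := c.frac_lt_limit N
    gcongr
  have h8 : (q N : ℝ) ^ k * (1 / (q N * q N ^ k) * A) = A / q N := by
    field_simp
  rw [h8, le_div_iff₀ hq] at h7
  have := hN N le_rfl
  linarith

end Chain

/-- The least `m` such that `f (Nat.pair b m)` is at least `t`. -/
noncomputable def level (f : ℕ → ℕ) (b t : ℕ) : ℕ := sInf {m | t ≤ f (Nat.pair b m)}

/-- The states defined by the oracle `f` and the sequence of free parameters `e`. -/
noncomputable def orbit (k X : ℕ) (u : ℤ) (w : ℕ) (f e : ℕ → ℕ) : ℕ → State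
  | 0 => start X u w
  | n + 1 => advance k
      (f (Nat.pair ((orbit k X u w f e n).2.2 ^ k)
        (level f ((orbit k X u w f e n).2.2 ^ k) (4 * (orbit k X u w f e n).2.2))))
      (level f ((orbit k X u w f e n).2.2 ^ k) (4 * (orbit k X u w f e n).2.2)) (e n)
      (orbit k X u w f e n)

/-! ### Reading Ψ from finite parts of the oracle -/

section Oracle

theorem exists_le_oracle {f : ℕ → ℕ} {Ψ : ℕ → ℝ} (hf : IsFunName f Ψ) (hΨ : Positive Ψ)
    {b : ℕ} (hb : 1 ≤ b) (t : ℕ) : ∃ m, t ≤ f (Nat.pair b m) := by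
  obtain ⟨m, hm⟩ := pow_unbounded_of_one_lt (((t : ℝ) + 1) / Ψ b) one_lt_two
  refine ⟨m, ?_⟩
  have h1 := (abs_le.1 (hf b hb m)).2
  have h2 : (0 : ℝ) < 2 ^ m := by positivity
  rw [div_lt_iff₀ (hΨ b hb)] at hm
  rw [sub_le_iff_le_add, ← add_div, le_div_iff₀ h2] at h1
  have : (t : ℝ) ≤ f (Nat.pair b m) := by linarith
  exact_mod_cast this

theorem le_oracle_level {f : ℕ → ℕ} {Ψ : ℕ → ℝ} (hf : IsFunName f Ψ) (hΨ : Positive Ψ)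
    {b : ℕ} (hb : 1 ≤ b) (t : ℕ) : t ≤ f (Nat.pair b (level f b t)) :=
  Nat.sInf_mem (s := {m | t ≤ f (Nat.pair b m)}) (exists_le_oracle hf hΨ hb t)

theorem getD_map_range (f : ℕ → ℕ) (N i : ℕ) :
    ((List.range N).map f).getD i 0 = if i < N then f i else 0 := by
  split_ifs with h
  · rw [List.getD_eq_getElem _ _ (by simpa using h)]
    simp
  · rw [List.getD_eq_default _ _ (by simpa using h)]

/-- The default 0 for missing entries never reaches t > 0, so an index that is found points at a
genuine entry. As `Nat.pair b` is increasing, all smaller indices are visible as well, and the index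
found is the true minimum, whatever the length of the list. -/
theorem findLevel_spec {f : ℕ → ℕ} {N b t : ℕ} (ht : 0 < t)
    (h : findLevel ((List.range N).map f) b t < ((List.range N).map f).length) :
    findLevel ((List.range N).map f) b t = level f b t ∧
      ((List.range N).map f).getD (Nat.pair b (level f b t)) 0 = f (Nat.pair b (level f b t)) := by
  set g : ℕ → Bool := fun m => decide (t ≤ ((List.range N).map f).getD (Nat.pair b m) 0)
  have hlen : (List.range ((List.range N).map f).length).findIdx g <
      (List.range ((List.range N).map f).length).length := by
    rw [List.length_range]
    exact h
  have h1 := List.findIdx_getElem (w := hlen)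
  rw [List.getElem_range, decide_eq_true_iff, getD_map_range] at h1
  set m := findLevel ((List.range N).map f) b t with hm
  change t ≤ if Nat.pair b m < N then f (Nat.pair b m) else 0 at h1
  have hp : Nat.pair b m < N := by
    by_contra hc
    rw [if_neg hc] at h1
    omega
  rw [if_pos hp] at h1
  have e : m = level f b t := by
    refine le_antisymm ?_ (Nat.sInf_le h1)
    by_contra hc
    rw [not_le] at hc
    have h2 := List.not_of_lt_findIdx (p := g) (xs := List.range ((List.range N).map f).length) hc
    rw [List.getElem_range] at h2
    simp only [g, getD_map_range, if_pos ((Nat.pair_lt_pair_right b hc).trans hp)] at h2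
    have h3 : t ≤ f (Nat.pair b (level f b t)) :=
      Nat.sInf_mem (s := {m | t ≤ f (Nat.pair b m)}) ⟨m, h1⟩
    simp [h3] at h2
  rw [e] at hp
  exact ⟨e, by rw [getD_map_range, if_pos hp]⟩

theorem findLevel_lt {f : ℕ → ℕ} {N b t : ℕ} (hex : ∃ m, t ≤ f (Nat.pair b m))
    (h : Nat.pair b (level f b t) < N) :
    findLevel ((List.range N).map f) b t < ((List.range N).map f).length := by
  have hl : level f b t < N := (Nat.right_le_pair _ _).trans_lt h
  have h1 : findLevel ((List.range N).map f) b t <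
      (List.range ((List.range N).map f).length).length := by
    refine List.findIdx_lt_length_of_exists ⟨level f b t, by simpa using hl, ?_⟩
    rw [getD_map_range, if_pos h, decide_eq_true_iff]
    exact Nat.sInf_mem (s := {m | t ≤ f (Nat.pair b m)}) hex
  simpa using h1

end Oracle

/-! ### Estimates for one step of the recursion -/

/-- The properties shared by all states that occur in the construction. -/
structure State.Good (X : ℕ) (z : State) : Prop where
  det : z.2.1 * z.1.2 - z.1.1 * z.2.2 = 1
  le : X + 3 ≤ z.2.2

/-- The first denominator is an inverse of the numerator w (X + 3) u + 1 modulo w^2 (X + 3). The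
term w (|u| + 1) makes it a natural number. The bound X + 3 brings all denominators into the range
where the decay of Ψ is known. -/
theorem good_start (X : ℕ) (u : ℤ) {w : ℕ} (hw : 0 < w) : (start X u w).Good X where
  det := by
    have hy : ((w * (|u| + 1) - u : ℤ).toNat : ℤ) = w * (|u| + 1) - u := by
      refine Int.toNat_of_nonneg ?_
      have h1 := le_abs_self u
      have h0 := abs_nonneg u
      have h2 : (1 : ℤ) ≤ w := by exact_mod_cast hw
      nlinarith
    simp only [start]
    push_cast
    rw [hy]
    ring
  le := by
    simp only [start]
    exact Nat.le_mul_of_pos_left _ (by positivity)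

/-- This makes the subtraction in the new denominator genuine and at least doubles the denominator.
-/
theorem le_multiplier (k F m e : ℕ) (z : State) : 2 + z.1.2 ≤ multiplier k F m e z := by
  rw [multiplier]
  generalize height k z.2.1 z.2.2 * 2 ^ m * (z.2.2 + 2) / (F * z.2.2 ^ 2) = a
  omega

theorem advance_den {X k F m e : ℕ} {z : State} (hz : z.Good X) :
    (((advance k F m e z).2.2 : ℕ) : ℤ) = multiplier k F m e z * z.2.2 - z.1.2 := by
  have h1 := le_multiplier k F m e z
  have h2 := hz.le
  simp only [advance]
  rw [Nat.cast_sub (by nlinarith)]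
  push_cast
  rfl

theorem good_advance {X k F m e : ℕ} {z : State} (hz : z.Good X) :
    (advance k F m e z).Good X where
  det := by
    rw [advance_den hz]
    simp only [advance]
    linear_combination hz.det
  le := by
    have h1 := le_multiplier k F m e z
    have h2 := hz.le
    have h3 := advance_den (k := k) (F := F) (m := m) (e := e) hz
    zify at *
    rw [h3]
    nlinarith

/-- `multiplier` exceeds the real number whose integer part it contains by `1 + s + e` to
`2 + s + e`; both bounds are scaled by `q`. -/
theorem multiplier_bounds (k F m e : ℕ) (z : State) (hF : 0 < F) (hq : 0 < z.2.2) :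
    (height k z.2.1 z.2.2 : ℝ) * 2 ^ m / F * (1 + 2 / z.2.2) ≤
        (multiplier k F m e z - 1 - z.1.2 - e) * z.2.2 ∧
      (multiplier k F m e z - 2 - z.1.2 - e) * (z.2.2 : ℝ) ≤
        (height k z.2.1 z.2.2 : ℝ) * 2 ^ m / F * (1 + 2 / z.2.2) := by
  set H := height k z.2.1 z.2.2
  set q := z.2.2
  have hqR : (0 : ℝ) < q := by positivity
  have hFR : (0 : ℝ) < F := by positivity
  have hpos : 0 < F * q ^ 2 := by positivity
  have e1 := Nat.div_mul_le_self (H * 2 ^ m * (q + 2)) (F * q ^ 2)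
  have e2 := Nat.lt_div_mul_add (a := H * 2 ^ m * (q + 2)) hpos
  have hA : (multiplier k F m e z : ℝ) =
      ((H * 2 ^ m * (q + 2) / (F * q ^ 2) : ℕ) : ℝ) + 2 + z.1.2 + e := by
    simp only [multiplier]
    push_cast
    rfl
  rw [hA]
  set D := H * 2 ^ m * (q + 2) / (F * q ^ 2)
  have e3 : (D : ℝ) * (F * q ^ 2) ≤ H * 2 ^ m * (q + 2) := by exact_mod_cast e1
  have e4 : (H : ℝ) * 2 ^ m * (q + 2) ≤ D * (F * q ^ 2) + F * q ^ 2 := by exact_mod_cast e2.le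
  have e5 : (H : ℝ) * 2 ^ m / F * (1 + 2 / q) = H * 2 ^ m * (q + 2) / (F * q) := by
    field_simp
  rw [e5, div_le_iff₀ (by positivity), le_div_iff₀ (by positivity)]
  constructor <;> nlinarith

/-- From F ≥ 4 q, the value F / 2^m has relative error at most about 1 / (4 q). The factor 1 + 2 / q
in the partial quotient outweighs this and still leaves 1 + 1 / q. Rounding and the summands 2 + s +
e cost O(q^2), which is O(1 / q) relative to a ratio of at least 2 q^3. The upper bound needs s ≤ q,
which may fail for the initial state. -/
theorem advance_bounds {X k F m e : ℕ} {z : State} {P : ℝ} (hz : z.Good X) (hk : 2 ≤ k)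
    (hP : 0 < P) (hs : P * z.2.2 ^ k ≤ 1 / 2) (hF : 4 * z.2.2 ≤ F)
    (hPF : |P - F / 2 ^ m| ≤ 1 / 2 ^ m) (he : e ≤ 1) :
    (1 + 1 / (z.2.2 : ℝ)) * (height k z.2.1 z.2.2 / P) ≤ (advance k F m e z).2.2 ∧
      (z.1.2 ≤ z.2.2 → ((advance k F m e z).2.2 : ℝ) ≤
        (1 + 10 / (z.2.2 : ℝ)) * (height k z.2.1 z.2.2 / P)) := by
  have hX := hz.le
  have hq3 : (3 : ℝ) ≤ z.2.2 := by exact_mod_cast (by omega : 3 ≤ z.2.2)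
  have hFR : 4 * (z.2.2 : ℝ) ≤ F := by exact_mod_cast hF
  obtain ⟨hA1, hA2⟩ := multiplier_bounds k F m e z (by omega) (by omega)
  have hden : (((advance k F m e z).2.2 : ℕ) : ℝ) =
      (multiplier k F m e z : ℝ) * z.2.2 - z.1.2 := by
    exact_mod_cast congrArg (Int.cast (R := ℝ)) (advance_den (k := k) (F := F) (m := m) (e := e) hz)
  have hT := pow_le_ratio (Ψ := fun _ => P) hk z.2.1 (by omega : 0 < z.2.2) hP hs
  rw [hden]
  have hT3 : 2 * (z.2.2 : ℝ) ^ 3 ≤ height k z.2.1 z.2.2 / P := by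
    refine le_trans ?_ hT
    rw [mul_assoc, ← pow_add]
    gcongr
    · linarith
    · omega
  have heR : (e : ℝ) ≤ 1 := by exact_mod_cast he
  have heR0 : (0 : ℝ) ≤ e := by positivity
  have hs0 : (0 : ℝ) ≤ z.1.2 := by positivity
  set A : ℝ := (multiplier k F m e z : ℝ)
  set q : ℝ := (z.2.2 : ℝ)
  set H : ℝ := (height k z.2.1 z.2.2 : ℝ)
  set T : ℝ := H / P with hTdef
  have hF0 : (0 : ℝ) < F := by linarith
  have hM : (0 : ℝ) < 2 ^ m := by positivity
  obtain ⟨hl, hu⟩ := abs_le.1 hPF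
  rw [← neg_div, le_sub_iff_add_le, ← add_div, div_le_iff₀ hM] at hl
  rw [sub_le_iff_le_add, ← add_div, le_div_iff₀ hM] at hu
  have hT0 : 0 < T := lt_of_lt_of_le (by positivity) hT3
  have e1 : H * 2 ^ m / F = T * (P * 2 ^ m / F) := by
    rw [hTdef]
    field_simp
  have hF1 : 1 / (F : ℝ) ≤ 1 / (4 * q) := one_div_le_one_div_of_le (by positivity) hFR
  have e2 : 1 - 1 / (4 * q) ≤ P * 2 ^ m / F := by
    refine le_trans (b := 1 - 1 / (F : ℝ)) (by linarith) ?_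
    rw [le_div_iff₀ hF0, sub_mul, one_div_mul_cancel hF0.ne']
    linarith
  have e3 : P * 2 ^ m / F ≤ 1 + 1 / (4 * q) := by
    refine le_trans (b := 1 + 1 / (F : ℝ)) ?_ (by linarith)
    rw [div_le_iff₀ hF0, add_mul, one_div_mul_cancel hF0.ne']
    linarith
  rw [e1] at hA1 hA2
  have hq0 : 0 < q := by linarith
  constructor
  · have a1 : (1 + 1 / q) ≤ (1 - 1 / (4 * q)) * (1 + 2 / q) := by
      have : (1 - 1 / (4 * q)) * (1 + 2 / q) - (1 + 1 / q) = (3 * q - 2) / (4 * q ^ 2) := by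
        field_simp
        ring
      have h2 : 0 ≤ (3 * q - 2) / (4 * q ^ 2) := div_nonneg (by linarith) (by positivity)
      linarith
    calc (1 + 1 / q) * T ≤ (1 - 1 / (4 * q)) * (1 + 2 / q) * T := by gcongr
      _ = T * (1 - 1 / (4 * q)) * (1 + 2 / q) := by ring
      _ ≤ T * (P * 2 ^ m / F) * (1 + 2 / q) := by gcongr
      _ ≤ (A - 1 - z.1.2 - e) * q := hA1
      _ ≤ A * q - z.1.2 := by nlinarith
  · intro hsq
    have hsqR : (z.1.2 : ℝ) ≤ q := Nat.cast_le.2 hsq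
    have a1 : (1 + 1 / (4 * q)) * (1 + 2 / q) + 5 / (4 * q) ≤ 1 + 10 / q := by
      have : 1 + 10 / q - ((1 + 1 / (4 * q)) * (1 + 2 / q) + 5 / (4 * q)) =
          (26 * q - 2) / (4 * q ^ 2) := by
        field_simp
        ring
      have h2 : 0 ≤ (26 * q - 2) / (4 * q ^ 2) := div_nonneg (by linarith) (by positivity)
      linarith
    have a2 : (3 + q) * q ≤ T * (5 / (4 * q)) := by
      calc (3 + q) * q ≤ 5 / 2 * q ^ 2 := by nlinarith
        _ = 2 * q ^ 3 * (5 / (4 * q)) := by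
          field_simp
          ring
        _ ≤ _ := by gcongr
    calc A * q - z.1.2 ≤ (A - 2 - z.1.2 - e) * q + (3 + q) * q := by nlinarith
      _ ≤ T * (P * 2 ^ m / F) * (1 + 2 / q) + T * (5 / (4 * q)) := add_le_add hA2 a2
      _ ≤ T * (1 + 1 / (4 * q)) * (1 + 2 / q) + T * (5 / (4 * q)) := by gcongr
      _ = ((1 + 1 / (4 * q)) * (1 + 2 / q) + 5 / (4 * q)) * T := by ring
      _ ≤ _ := by gcongr

/-! ### The orbit is a chain; location and separation of limits -/

section Orbit

variable {k X : ℕ} {u : ℤ} {w : ℕ} {f e : ℕ → ℕ}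

theorem good_orbit (hw : 0 < w) (n : ℕ) : (orbit k X u w f e n).Good X := by
  induction n with
  | zero => exact good_start X u hw
  | succ n ih => exact good_advance ih

theorem orbit_fst_succ (n : ℕ) : (orbit k X u w f e (n + 1)).1 = (orbit k X u w f e n).2 := rfl

theorem chain_orbit {Ψ : ℕ → ℝ} {d : ℝ} (hk : 2 ≤ k) (hw : 0 < w) (hΨ : Positive Ψ)
    (hd : d ≤ 1 / 2) (hX : DecaysFrom X d Ψ) (hf : IsFunName f Ψ) (he : ∀ n, e n ≤ 1) :
    Chain k Ψ (fun n => (orbit k X u w f e n).2.1) fun n => (orbit k X u w f e n).2.2 := by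
  have hpos : ∀ n, 1 ≤ (orbit k X u w f e n).2.2 ^ k := fun n =>
    Nat.one_le_pow _ _ (by have := (good_orbit (k := k) (X := X) (u := u) (f := f) (e := e) hw n).le; omega)
  have hsmall : ∀ n, Ψ ((orbit k X u w f e n).2.2 ^ k) *
      (((orbit k X u w f e n).2.2 : ℕ) : ℝ) ^ k ≤ 1 / 2 := by
    intro n
    have h1 := (good_orbit (k := k) (X := X) (u := u) (f := f) (e := e) hw n).le
    have h2 := hX _ (hpos n)
      ((by omega : X ≤ (orbit k X u w f e n).2.2).trans (Nat.le_self_pow (by omega) _))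
    have h3 : (0 : ℝ) < (((orbit k X u w f e n).2.2 ^ k : ℕ) : ℝ) := by exact_mod_cast hpos n
    rw [lt_div_iff₀ h3] at h2
    push_cast at h2
    linarith
  have hb := fun n => advance_bounds (e := e n)
    (good_orbit (k := k) (X := X) (u := u) (f := f) (e := e) hw n) hk (hΨ _ (hpos n)) (hsmall n)
    (le_oracle_level hf hΨ (hpos n) _) (hf _ (hpos n) _) (he n)
  refine ⟨hk, fun n => ?_, ?_, fun n => hΨ _ (hpos n), hsmall, fun n => (hb n).1, ?_⟩
  · have := (good_orbit (k := k) (X := X) (u := u) (f := f) (e := e) hw (n + 1)).det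
    rw [orbit_fst_succ] at this
    exact this
  · have := (good_orbit (k := k) (X := X) (u := u) (f := f) (e := e) hw 0).le
    omega
  · intro n hn
    obtain ⟨n, rfl⟩ := Nat.exists_eq_succ_of_ne_zero (by omega : n ≠ 0)
    refine (hb (n + 1)).2 ?_
    rw [orbit_fst_succ]
    have h1 := le_multiplier k (f (Nat.pair ((orbit k X u w f e n).2.2 ^ k)
        (level f ((orbit k X u w f e n).2.2 ^ k) (4 * (orbit k X u w f e n).2.2))))
      (level f ((orbit k X u w f e n).2.2 ^ k) (4 * (orbit k X u w f e n).2.2)) (e n)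
      (orbit k X u w f e n)
    have h2 := (good_orbit (k := k) (X := X) (u := u) (f := f) (e := e) hw n)
    have h3 := advance_den (k := k) (F := f (Nat.pair ((orbit k X u w f e n).2.2 ^ k)
        (level f ((orbit k X u w f e n).2.2 ^ k) (4 * (orbit k X u w f e n).2.2))))
      (m := level f ((orbit k X u w f e n).2.2 ^ k) (4 * (orbit k X u w f e n).2.2)) (e := e n) h2
    have h4 := h2.le
    change (orbit k X u w f e n).2.2 ≤ (advance _ _ _ _ _).2.2
    zify at *
    rw [h3]
    nlinarith

theorem limit_orbit_mem (hw : 0 < w) {v : ℤ} (huv : u < v) {Ψ : ℕ → ℝ}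
    (c : Chain k Ψ (fun n => (orbit k X u w f e n).2.1) fun n => (orbit k X u w f e n).2.2) :
    limit (fun n => (orbit k X u w f e n).2.1) (fun n => (orbit k X u w f e n).2.2) ∈
      ratInterval u v w := by
  have h1 := c.frac_lt_limit 0
  have h2 := c.limit_le 0
  have hp : (orbit k X u w f e 0).2.1 = w * (X + 3) * u + 1 := rfl
  have hq : (orbit k X u w f e 0).2.2 = w ^ 2 * (X + 3) := rfl
  simp only [hp, hq] at h1 h2
  set ζ := limit (fun n => (orbit k X u w f e n).2.1) (fun n => (orbit k X u w f e n).2.2)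
  have hwR : (1 : ℝ) ≤ w := by exact_mod_cast hw
  have hXR : (0 : ℝ) ≤ X := by positivity
  push_cast at h1 h2
  have hx : ((w : ℝ) * (X + 3) * u + 1) / (w ^ 2 * (X + 3)) = u / w + 1 / (w ^ 2 * (X + 3)) := by
    field_simp
  rw [hx] at h1 h2
  have hpos : (0 : ℝ) < 1 / (w ^ 2 * (X + 3)) := by positivity
  have h3 : (w : ℝ) * 3 ≤ w ^ 2 * (X + 3) := by nlinarith
  have h4 : 1 / ((w : ℝ) ^ 2 * (X + 3)) ≤ 1 / (w * 3) :=
    one_div_le_one_div_of_le (by positivity) h3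
  have h5 : 1 / ((w : ℝ) ^ 2 * (X + 3)) ^ 2 ≤ 1 / (w * 3) := by
    refine one_div_le_one_div_of_le (by positivity) (h3.trans ?_)
    exact le_self_pow₀ (by nlinarith) (by norm_num)
  have h6 : (u : ℝ) + 1 ≤ v := by exact_mod_cast huv
  refine ⟨by linarith, ?_⟩
  -- The limit exceeds u / w by at most two thirds of 1 / w, and the interval has length at least 1
  -- / w.
  have h7 : (u : ℝ) / w + 1 / (w * 3) + 1 / (w * 3) < (u + 1) / w := by
    rw [add_div]
    have : 1 / ((w : ℝ) * 3) = 1 / w / 3 := by field_simp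
    have h8 : 0 < 1 / (w : ℝ) := by positivity
    linarith
  have h8 : ((u : ℝ) + 1) / w ≤ v / w := by gcongr
  linarith

theorem orbit_congr {e' : ℕ → ℕ} {n : ℕ} (h : ∀ m < n, e m = e' m) :
    orbit k X u w f e n = orbit k X u w f e' n := by
  induction n with
  | zero => rfl
  | succ n ih =>
    have ih' := ih fun m hm => h m (by omega)
    simp only [orbit, ih', h n (by omega)]

/-- A larger parameter at the first difference raises the next denominator by at least the current
one. This moves the next fraction down by more than the limit can regain afterwards. -/
theorem limit_orbit_lt {e' : ℕ → ℕ} {n : ℕ} (hw : 0 < w) (h : ∀ m < n, e m = e' m)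
    (hlt : e n < e' n) {Ψ : ℕ → ℝ}
    (c : Chain k Ψ (fun n => (orbit k X u w f e n).2.1) fun n => (orbit k X u w f e n).2.2)
    (c' : Chain k Ψ (fun n => (orbit k X u w f e' n).2.1) fun n => (orbit k X u w f e' n).2.2) :
    limit (fun n => (orbit k X u w f e' n).2.1) (fun n => (orbit k X u w f e' n).2.2) <
      limit (fun n => (orbit k X u w f e n).2.1) (fun n => (orbit k X u w f e n).2.2) := by
  have hn := orbit_congr (k := k) (X := X) (u := u) (w := w) (f := f) h
  have h1 := c.frac_lt_limit (n + 1)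
  have h2 := c'.limit_le (n + 1)
  rw [c.frac_succ] at h1
  rw [c'.frac_succ] at h2
  simp only [← hn] at h2
  refine h2.trans_lt (lt_of_le_of_lt ?_ h1)
  have hq := c.q_pos n
  have hQ := c.q_pos (n + 1)
  have hQ' := c'.q_pos (n + 1)
  have hle : (((orbit k X u w f e (n + 1)).2.2 : ℕ) : ℝ) + (orbit k X u w f e n).2.2 ≤
      ((orbit k X u w f e' (n + 1)).2.2 : ℕ) := by
    have g := good_orbit (k := k) (X := X) (u := u) (f := f) (e := e) hw n
    have a1 := advance_den (k := k) (F := f (Nat.pair ((orbit k X u w f e n).2.2 ^ k)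
        (level f ((orbit k X u w f e n).2.2 ^ k) (4 * (orbit k X u w f e n).2.2))))
      (m := level f ((orbit k X u w f e n).2.2 ^ k) (4 * (orbit k X u w f e n).2.2)) (e := e n) g
    have a2 := advance_den (k := k) (F := f (Nat.pair ((orbit k X u w f e n).2.2 ^ k)
        (level f ((orbit k X u w f e n).2.2 ^ k) (4 * (orbit k X u w f e n).2.2))))
      (m := level f ((orbit k X u w f e n).2.2 ^ k) (4 * (orbit k X u w f e n).2.2)) (e := e' n) g
    have a3 : (((orbit k X u w f e (n + 1)).2.2 : ℕ) : ℤ) + (orbit k X u w f e n).2.2 ≤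
        ((orbit k X u w f e' (n + 1)).2.2 : ℕ) := by
      simp only [orbit, ← hn]
      rw [a1, a2]
      simp only [multiplier]
      push_cast
      have : (e n : ℤ) + 1 ≤ e' n := by exact_mod_cast hlt
      have := mul_le_mul_of_nonneg_right this (Int.natCast_nonneg (orbit k X u w f e n).2.2)
      linarith
    exact_mod_cast a3
  set q : ℝ := (((orbit k X u w f e n).2.2 : ℕ) : ℝ)
  set Q : ℝ := (((orbit k X u w f e (n + 1)).2.2 : ℕ) : ℝ)
  set Q' : ℝ := (((orbit k X u w f e' (n + 1)).2.2 : ℕ) : ℝ)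
  have key : 1 / (q * Q') + 1 / Q' ^ 2 ≤ 1 / (q * Q) := by
    have : 1 / (q * Q) - (1 / (q * Q') + 1 / Q' ^ 2) = (Q' * (Q' - Q) - q * Q) / (q * Q * Q' ^ 2) := by
      field_simp
      ring
    have h3 : 0 ≤ (Q' * (Q' - Q) - q * Q) / (q * Q * Q' ^ 2) :=
      div_nonneg (by nlinarith) (by positivity)
    linarith
  linarith

end Orbit

/-! ### Correctness of the algorithm -/

section Run

variable {k X : ℕ} {u : ℤ} {w : ℕ} {f : ℕ → ℕ}

theorem eq_orbit_of_run {N n : ℕ} {z : State} (hw : 0 < w)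
    (h : run ((List.range N).map f) k X u w n = some z) :
    z = orbit k X u w f (fun _ => 0) n := by
  induction n generalizing z with
  | zero => exact (Option.some.inj h).symm
  | succ n ih =>
    change (run ((List.range N).map f) k X u w n).bind (advance? ((List.range N).map f) k) =
      some z at h
    obtain ⟨y, hy, hz⟩ := Option.bind_eq_some_iff.1 h
    have hy' := ih hy
    have g := good_orbit (k := k) (X := X) (u := u) (f := f) (e := fun _ => 0) hw n
    rw [← hy'] at g
    have g3 := g.le
    rw [advance?] at hz
    split_ifs at hz with hlt
    obtain ⟨e1, e2⟩ := findLevel_spec (by omega) hlt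
    rw [e1, e2] at hz
    simp only [orbit, ← hy']
    exact (Option.some.inj hz).symm

theorem eventually_run_eq {Ψ : ℕ → ℝ} (hw : 0 < w) (hΨ : Positive Ψ) (hf : IsFunName f Ψ)
    (n : ℕ) : ∃ N₀, ∀ N ≥ N₀, run ((List.range N).map f) k X u w n =
      some (orbit k X u w f (fun _ => 0) n) := by
  induction n with
  | zero => exact ⟨0, fun N _ => rfl⟩
  | succ n ih =>
    obtain ⟨N₀, h⟩ := ih
    set y := orbit k X u w f (fun _ => 0) n with hy
    have g3 := (good_orbit (k := k) (X := X) (u := u) (f := f) (e := fun _ => 0) hw n).le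
    rw [← hy] at g3
    refine ⟨max N₀ (Nat.pair (y.2.2 ^ k) (level f (y.2.2 ^ k) (4 * y.2.2)) + 1), fun N hN => ?_⟩
    change (run ((List.range N).map f) k X u w n).bind (advance? ((List.range N).map f) k) = _
    rw [h N ((le_max_left _ _).trans hN), Option.bind_some, advance?]
    have hlt := findLevel_lt (f := f) (N := N) (b := y.2.2 ^ k) (t := 4 * y.2.2)
      (exists_le_oracle hf hΨ (Nat.one_le_pow _ _ (by omega)) _)
      (lt_of_lt_of_le (Nat.lt_succ_self _) ((le_max_right _ _).trans hN))
    obtain ⟨e1, e2⟩ := findLevel_spec (by omega) hlt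
    rw [if_pos hlt, e1, e2]
    rfl

theorem abs_sub_nat_round_le (a q : ℕ) (hq : 0 < q) :
    |(a : ℝ) / q - ((2 * a + q) / (2 * q) : ℕ)| ≤ 1 / 2 := by
  have hqR : (0 : ℝ) < q := by positivity
  have e1 := Nat.div_mul_le_self (2 * a + q) (2 * q)
  have e2 := Nat.lt_div_mul_add (a := 2 * a + q) (by omega : 0 < 2 * q)
  set D := (2 * a + q) / (2 * q)
  have e3 : (D : ℝ) * (2 * q) ≤ 2 * a + q := by exact_mod_cast e1
  have e4 : 2 * (a : ℝ) + q ≤ D * (2 * q) + 2 * q := by exact_mod_cast e2.le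
  have e5 : (a : ℝ) / q - D = (a - D * q) / q := by field_simp
  rw [e5, abs_le, le_div_iff₀ hqR, div_le_iff₀ hqR]
  constructor <;> linarith

theorem abs_sub_dyadicRound_le (p : ℤ) (q n : ℕ) (hq : 0 < q) :
    |(p : ℝ) / q - dyadicRound p q n / 2 ^ n| ≤ 1 / 2 / 2 ^ n := by
  have hM : (0 : ℝ) < 2 ^ n := by positivity
  have h0 : q / (2 * q) = 0 := Nat.div_eq_of_lt (by omega)
  have e : (p : ℝ) / q - dyadicRound p q n / 2 ^ n =
      ((p : ℝ) * 2 ^ n / q - dyadicRound p q n) / 2 ^ n := by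
    field_simp
  rw [e, abs_div, abs_of_pos hM]
  gcongr
  rcases le_total 0 p with hp | hp
  · obtain ⟨a, rfl⟩ := Int.eq_ofNat_of_zero_le hp
    have h := abs_sub_nat_round_le (a * 2 ^ n) q hq
    have e2 : dyadicRound a q n = ((2 * (a * 2 ^ n) + q) / (2 * q) : ℕ) := by
      simp [dyadicRound, h0, mul_assoc]
    rw [e2, Int.cast_natCast, Int.cast_natCast]
    rwa [Nat.cast_mul, Nat.cast_pow, Nat.cast_ofNat] at h
  · obtain ⟨a, ha⟩ := Int.eq_ofNat_of_zero_le (neg_nonneg.2 hp)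
    obtain rfl : p = -(a : ℤ) := by omega
    have h := abs_sub_nat_round_le (a * 2 ^ n) q hq
    have e2 : dyadicRound (-a) q n = -((2 * (a * 2 ^ n) + q) / (2 * q) : ℕ) := by
      simp [dyadicRound, h0, mul_assoc]
    rw [e2, Int.cast_neg, Int.cast_neg, Int.cast_natCast, Int.cast_natCast, neg_mul, neg_div,
      ← neg_sub_neg, neg_neg, neg_neg, abs_sub_comm]
    rwa [Nat.cast_mul, Nat.cast_pow, Nat.cast_ofNat] at h

/-- Half of the admissible error 2^(-n) goes to rounding. The other half covers the distance to the
limit, which is at most 1 / q_n^2 with q_n ≥ 2^(n+1). -/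
theorem isRealName_orbit {Ψ : ℕ → ℝ} {e : ℕ → ℕ}
    (c : Chain k Ψ (fun n => (orbit k X u w f e n).2.1) fun n => (orbit k X u w f e n).2.2) :
    IsRealName (fun n => dyadicRound (orbit k X u w f e n).2.1 (orbit k X u w f e n).2.2 n)
      (limit (fun n => (orbit k X u w f e n).2.1) (fun n => (orbit k X u w f e n).2.2)) := by
  intro n
  have h2 := c.two_le n
  have h1 := abs_sub_dyadicRound_le (orbit k X u w f e n).2.1 (orbit k X u w f e n).2.2 n
    (by omega)
  have h3 := c.frac_lt_limit n
  have h4 := c.limit_le n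
  have h5 : (2 : ℝ) ^ (n + 1) ≤ ((orbit k X u w f e n).2.2 : ℕ) := by
    exact_mod_cast c.two_pow_le n
  have h7 := c.two_le_cast n
  set x : ℝ := ((orbit k X u w f e n).2.1 : ℝ) / ((orbit k X u w f e n).2.2 : ℕ)
  have h6 : 1 / (((orbit k X u w f e n).2.2 : ℕ) : ℝ) ^ 2 ≤ 1 / 2 / 2 ^ n := by
    rw [div_div, ← pow_succ']
    refine one_div_le_one_div_of_le (by positivity) (h5.trans ?_)
    exact le_self_pow₀ (by linarith) (by norm_num)
  have e1 : |limit (fun n => (orbit k X u w f e n).2.1) (fun n => (orbit k X u w f e n).2.2) - x|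
      ≤ 1 / 2 / 2 ^ n := by
    rw [abs_of_pos (by linarith)]
    linarith
  refine (abs_sub_le _ x _).trans ((add_le_add e1 h1).trans_eq ?_)
  ring

theorem oracleComputes_algorithm {Ψ : ℕ → ℝ} (v : ℤ) (hw : 0 < w) (hΨ : Positive Ψ)
    (hf : IsFunName f Ψ) : OracleComputes algorithm f (k, X, u, v, w)
      fun n => dyadicRound (orbit k X u w f (fun _ => 0) n).2.1
        (orbit k X u w f (fun _ => 0) n).2.2 n := by
  refine fun n => ⟨?_, fun N m h => ?_⟩
  · obtain ⟨N, hN⟩ := eventually_run_eq (k := k) (X := X) (u := u) hw hΨ hf n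
    refine ⟨N, ?_⟩
    change (run ((List.range N).map f) k X u w n).map _ = _
    rw [hN N le_rfl]
    rfl
  · change (run ((List.range N).map f) k X u w n).map _ = _ at h
    obtain ⟨z, hz, rfl⟩ := Option.map_eq_some_iff.1 h
    rw [eq_orbit_of_run hw hz]

end Run

/-! ### Large solutions come from powers of one fraction -/

section RationalStructure

theorem abs_pow_sub_pow_le_of_le {x y R : ℝ} {j k : ℕ} (hj : j < k) (hx : |x| ≤ R) (hy : |y| ≤ R) :
    |x ^ (j + 1) - y ^ (j + 1)| ≤ |x - y| * (k * max R 1 ^ k) := by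
  refine (abs_pow_sub_pow_le x y (j + 1)).trans ?_
  rw [mul_assoc]
  gcongr
  · exact_mod_cast hj
  · rw [Nat.add_sub_cancel]
    calc max |x| |y| ^ j ≤ max R 1 ^ j := by
          exact pow_le_pow_left₀ (le_max_of_le_left (abs_nonneg x))
            (max_le (hx.trans (le_max_left _ _)) (hy.trans (le_max_left _ _))) j
      _ ≤ max R 1 ^ k := pow_le_pow_right₀ (le_max_right _ _) hj.le

theorem pow_dvd_of_mul_pow_eq {a P : ℤ} {b N j : ℕ} (hab : IsCoprime a b)
    (h : P * (b : ℤ) ^ j = N * a ^ j) : b ^ j ∣ N := by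
  have h1 : ((b : ℤ)) ^ j ∣ N := (hab.symm.pow (m := j) (n := j)).dvd_of_dvd_mul_right ⟨P, by
    linarith⟩
  exact_mod_cast h1

/-- As b^j divides N, the number N (a / b)^(j+1) has denominator dividing b. A distance below 1 / b
from the integer P therefore forces equality. -/
theorem eq_of_abs_sub_lt {a P : ℤ} {b N j : ℕ} {r : ℝ} (hb : 0 < b) (hN : b ^ j ∣ N)
    (h : |(N : ℝ) * ((a : ℝ) / b) ^ (j + 1) - P| ≤ r) (hr : b * r < 1) :
    P * (b : ℤ) ^ (j + 1) = N * a ^ (j + 1) := by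
  obtain ⟨c, rfl⟩ := hN
  have hbR : (0 : ℝ) < b := by positivity
  have e : ((c * a ^ (j + 1) - P * b : ℤ) : ℝ) =
      (((b ^ j * c : ℕ) : ℝ) * ((a : ℝ) / b) ^ (j + 1) - P) * b := by
    push_cast
    rw [div_pow, pow_succ (b : ℝ)]
    field_simp
  have h1 : |((c * a ^ (j + 1) - P * b : ℤ) : ℝ)| < 1 := by
    rw [e, abs_mul, abs_of_pos hbR]
    nlinarith
  have h2 : c * a ^ (j + 1) - P * b = 0 := Int.abs_lt_one_iff.1 (by exact_mod_cast h1)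
  push_cast
  rw [pow_succ (b : ℤ)]
  linear_combination (-(b : ℤ) ^ j) * h2

/-- All solutions with a large denominator `N` are multiples of the vectors
`(b ^ k, a * b ^ (k - 1), …, a ^ k)`. -/
theorem exists_eq_mul_pow {k X : ℕ} {Ψ : ℕ → ℝ} {ζ d R : ℝ} (hk : 2 ≤ k) (hζ : Irrational ζ)
    (hR : |ζ| < R) (hd : 0 < d) (hdR : d * (1 + 2 * R) ≤ 1) (hX : DecaysFrom X d Ψ) (B : ℕ) :
    ∃ N₀ : ℕ, ∀ (N : ℕ) (P : Fin k → ℤ), N₀ ≤ N →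
      (∀ j : Fin k, |ζ ^ ((j : ℕ) + 1) * (N : ℝ) - P j| ≤ Ψ N) →
      ∃ (a : ℤ) (b l : ℕ), B ≤ b ∧ IsCoprime a b ∧ N = l * b ^ k ∧
        ∀ j : Fin k, P j * (b : ℤ) ^ ((j : ℕ) + 1) = N * a ^ ((j : ℕ) + 1) := by
  have hR0 : 0 < R := (abs_nonneg ζ).trans_lt hR
  set L : ℝ := k * max R 1 ^ k
  have hL : 0 ≤ L := by positivity
  obtain ⟨B', hB'⟩ := exists_nat_gt (d * (1 + L))
  -- Fractions with bounded denominator keep a positive distance from the irrational ζ, so for large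
  -- N the reduced denominator b of P_1 / N exceeds any given bound.
  obtain ⟨ε, hε, hε0⟩ := ((hζ.eventually_forall_le_dist_cast_div_of_denom_le (max B B')).filter_mono
    nhdsWithin_le_nhds |>.and (self_mem_nhdsWithin (s := Ioi (0 : ℝ)))).exists
  have hε0' : 0 < ε := hε0
  obtain ⟨N₁, hN₁⟩ := exists_nat_gt (d / ε)
  obtain ⟨N₂, hN₂⟩ := exists_nat_gt (d / (R - |ζ|))
  refine ⟨max (max N₁ N₂) (max X 1), fun N P hN hP => ?_⟩
  have hN1 : N₁ ≤ N := ((le_max_left _ _).trans (le_max_left _ _)).trans hN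
  have hN2 : N₂ ≤ N := ((le_max_right _ _).trans (le_max_left _ _)).trans hN
  have hNX : X ≤ N := ((le_max_left _ _).trans (le_max_right _ _)).trans hN
  have hNpos : 1 ≤ N := ((le_max_right _ _).trans (le_max_right _ _)).trans hN
  have hNR : (1 : ℝ) ≤ N := by exact_mod_cast hNpos
  have hΨ := hX N hNpos hNX
  obtain ⟨a, b', hg, ha, hb'⟩ := Int.exists_gcd_one (m := P ⟨0, by omega⟩) (n := N)
    (Int.gcd_pos_of_ne_zero_right _ (by omega))
  have hgpos : 0 < Int.gcd (P ⟨0, by omega⟩) N := Int.gcd_pos_of_ne_zero_right _ (by omega)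
  set g := Int.gcd (P ⟨0, by omega⟩) N
  have hb'pos : 0 < b' := by
    have : (0 : ℤ) < b' * g := by rw [← hb']; omega
    exact pos_of_mul_pos_left this (by omega)
  obtain ⟨b, rfl⟩ := Int.eq_ofNat_of_zero_le hb'pos.le
  have hb : 0 < b := by exact_mod_cast hb'pos
  have hNb : N = b * g := by exact_mod_cast hb'
  have hab : IsCoprime a (b : ℤ) := Int.isCoprime_iff_gcd_eq_one.2 hg
  have hbR : (0 : ℝ) < b := by positivity
  have hP0 : (P ⟨0, by omega⟩ : ℝ) = N * ((a : ℝ) / b) := by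
    rw [ha, hNb]
    push_cast
    field_simp
  have hdist : |ζ - (a : ℝ) / b| * N ≤ Ψ N := by
    have := hP ⟨0, by omega⟩
    rw [hP0] at this
    rw [← abs_of_pos (by linarith : (0 : ℝ) < N), ← abs_mul]
    refine (congrArg abs ?_).trans_le this
    rw [Nat.zero_add, pow_one]
    ring
  have hdist' : |ζ - (a : ℝ) / b| ≤ d / N := by
    refine le_trans ?_ (hdist.trans hΨ.le)
    exact le_mul_of_one_le_right (abs_nonneg _) hNR
  have hbB : max B B' < b := by
    by_contra hc
    have h1 := hε b (not_lt.1 hc) a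
    rw [Real.dist_eq] at h1
    have h2 : d / N < ε := by
      rw [div_lt_iff₀ (by linarith)]
      rw [div_lt_iff₀ hε0'] at hN₁
      have : (N₁ : ℝ) ≤ N := by exact_mod_cast hN1
      nlinarith
    linarith
  have hxR : |(a : ℝ) / b| ≤ R := by
    have h2 : d / N ≤ R - |ζ| := by
      rw [div_le_iff₀ (by linarith)]
      rw [div_lt_iff₀ (by linarith)] at hN₂
      have : (N₂ : ℝ) ≤ N := by exact_mod_cast hN2
      nlinarith
    have h3 := abs_sub_abs_le_abs_sub ((a : ℝ) / b) ζ
    rw [abs_sub_comm] at h3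
    linarith
  have hbNR : (b : ℝ) ≤ N := by
    exact_mod_cast hNb ▸ Nat.le_mul_of_pos_right b hgpos
  have hΨ0 : 0 ≤ Ψ N := (mul_nonneg (abs_nonneg _) (by linarith)).trans hdist
  have key : ∀ j : ℕ, ∀ hj : j < k, P ⟨j, hj⟩ * (b : ℤ) ^ (j + 1) = N * a ^ (j + 1) := by
    intro j
    induction j with
    | zero =>
      intro hj
      rw [ha, hNb]
      push_cast
      ring
    | succ j ih =>
      intro hj
      have hdvd := pow_dvd_of_mul_pow_eq hab (ih (by omega))
      have hsol := hP ⟨j + 1, hj⟩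
      simp only at hsol
      have tri : ∀ M : ℝ, |ζ ^ (j + 1 + 1) - ((a : ℝ) / b) ^ (j + 1 + 1)| ≤ |ζ - (a : ℝ) / b| * M →
          0 ≤ M →
          |(N : ℝ) * ((a : ℝ) / b) ^ (j + 1 + 1) - P ⟨j + 1, hj⟩| ≤ Ψ N * (1 + M) := by
        intro M hM hM0
        have e : (N : ℝ) * ((a : ℝ) / b) ^ (j + 1 + 1) - P ⟨j + 1, hj⟩ =
            (ζ ^ (j + 1 + 1) * N - P ⟨j + 1, hj⟩) -
              N * (ζ ^ (j + 1 + 1) - ((a : ℝ) / b) ^ (j + 1 + 1)) := by ring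
        rw [e]
        refine (abs_sub _ _).trans ?_
        rw [abs_mul, abs_of_pos (by linarith : (0 : ℝ) < N)]
        have h1 : N * |ζ ^ (j + 1 + 1) - ((a : ℝ) / b) ^ (j + 1 + 1)| ≤ Ψ N * M := by
          calc N * |ζ ^ (j + 1 + 1) - ((a : ℝ) / b) ^ (j + 1 + 1)| ≤
              N * (|ζ - (a : ℝ) / b| * M) := by gcongr
            _ = |ζ - (a : ℝ) / b| * N * M := by ring
            _ ≤ Ψ N * M := by gcongr
        linarith
      rcases Nat.eq_zero_or_pos j with rfl | hjpos
      -- For the square only b ≤ N is available, so the precise constant matters: this is where d (1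
      -- + 2 R) ≤ 1 enters.
      · have hM : |ζ ^ 2 - ((a : ℝ) / b) ^ 2| ≤ |ζ - (a : ℝ) / b| * (2 * R) := by
          rw [sq_sub_sq, abs_mul, mul_comm]
          gcongr
          exact (abs_add_le _ _).trans (by linarith)
        refine eq_of_abs_sub_lt hb hdvd (tri _ hM (by linarith)) ?_
        calc b * (Ψ N * (1 + 2 * R)) ≤ N * (Ψ N * (1 + 2 * R)) := by gcongr
          _ < N * (d / N * (1 + 2 * R)) := by gcongr
          _ = d * (1 + 2 * R) := by field_simp
          _ ≤ 1 := hdR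
      -- For higher powers b^2 divides N, which gains a factor b and makes any Lipschitz constant L
      -- harmless once b > d (1 + L).
      · refine eq_of_abs_sub_lt hb hdvd
          (tri L (abs_pow_sub_pow_le_of_le hj hR.le hxR) hL) ?_
        have hsq : b ^ 2 ≤ N := (Nat.pow_le_pow_right hb (by omega)).trans
          (Nat.le_of_dvd (by omega) hdvd)
        have hsqR : (b : ℝ) ^ 2 ≤ N := by exact_mod_cast hsq
        have hBb : (B' : ℝ) < b := by
          exact_mod_cast (le_max_right _ _).trans_lt hbB
        calc b * (Ψ N * (1 + L)) ≤ b * (d / N * (1 + L)) := by gcongr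
          _ ≤ b * (d / b ^ 2 * (1 + L)) := by gcongr
          _ = d * (1 + L) / b := by field_simp
          _ < 1 := by
            rw [div_lt_one hbR]
            linarith
  have hdvd : b ^ k ∣ N := by
    obtain ⟨i, rfl⟩ := Nat.exists_eq_succ_of_ne_zero (by omega : k ≠ 0)
    exact pow_dvd_of_mul_pow_eq hab (key i (Nat.lt_succ_self i))
  obtain ⟨l, hl⟩ := hdvd
  exact ⟨a, b, l, (le_max_left _ _).trans hbB.le, hab, by rw [hl, mul_comm],
    fun j => key j j.2⟩

end RationalStructure

/-- For each first coordinate only finitely many integer vectors satisfy the inequalities. -/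
theorem exists_large_of_infinite {k : ℕ} {Ψ : ℕ → ℝ} {ζ : ℝ} {S : Set (ℕ × (Fin k → ℤ))}
    (hS : S ⊆ solutions k Ψ ζ) (hinf : S.Infinite) (N : ℕ) : ∃ v ∈ S, N ≤ v.1 := by
  by_contra! hc
  refine hinf ?_
  have hfin : (⋃ n ∈ Set.Iio N, ({n} : Set ℕ) ×ˢ (Set.univ.pi fun j : Fin k =>
      Set.Icc ⌊ζ ^ ((j : ℕ) + 1) * n - Ψ n⌋ ⌈ζ ^ ((j : ℕ) + 1) * n + Ψ n⌉)).Finite :=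
    (Set.finite_Iio N).biUnion fun n _ =>
      (Set.finite_singleton n).prod (Set.Finite.pi fun j => Set.finite_Icc _ _)
  refine hfin.subset fun v hv => ?_
  simp only [Set.mem_iUnion]
  refine ⟨v.1, hc v hv, rfl, fun j _ => ?_⟩
  obtain ⟨h1, h2⟩ := abs_le.1 ((hS hv).2 j)
  constructor
  · exact_mod_cast (Int.floor_le _).trans (by linarith : _ ≤ (v.2 j : ℝ))
  · exact_mod_cast (by linarith : (v.2 j : ℝ) ≤ _).trans (Int.le_ceil _)

/-! ### Exactness of the limit -/

namespace Chain

variable {k : ℕ} {Ψ : ℕ → ℝ} {p : ℕ → ℤ} {q : ℕ → ℕ} (c : Chain k Ψ p q)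

include c

theorem isCoprime (n : ℕ) : IsCoprime (p n) (q n) :=
  ⟨-(q (n + 1) : ℤ), p (n + 1), by linear_combination c.det n⟩

theorem infinite_solutions :
    {v ∈ solutions k Ψ (limit p q) | IsRelPrime v}.Infinite := by
  obtain ⟨N, hN⟩ := c.eventually_abs_pow_sub_le
  have hk := c.two_le_k
  refine Set.infinite_of_injective_forall_mem
    (f := fun n => (q (N + n) ^ k, fun j : Fin k =>
      p (N + n) ^ ((j : ℕ) + 1) * (q (N + n) : ℤ) ^ (k - 1 - j))) ?_ ?_
  · intro m n hmn
    have h := Nat.pow_left_injective (by omega : k ≠ 0) (congrArg Prod.fst hmn)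
    have := c.q_strictMono.injective h
    omega
  · intro n
    have hq := c.q_pos (N + n)
    have hq2 := c.two_le (N + n)
    refine ⟨⟨Nat.one_le_pow _ _ (by omega), fun j => ?_⟩, fun d hd hdj => ?_⟩
    · have h := hN (N + n) (by omega) j j.2
      rw [le_div_iff₀ (by positivity), ← abs_of_pos (pow_pos hq k), ← abs_mul] at h
      have e : (q (N + n) : ℝ) ^ k = q (N + n) ^ ((j : ℕ) + 1) * q (N + n) ^ (k - 1 - j) := by
        rw [← pow_add]
        congr 1
        have := j.2
        omega
      push_cast
      refine (congrArg abs ?_).trans_le h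
      rw [e, div_pow]
      field_simp
    -- A common divisor divides the first coordinate q^k and the last coordinate p^k, which are
    -- coprime.
    · have h1 := hdj ⟨k - 1, by omega⟩
      simp only [Nat.sub_self, pow_zero, mul_one] at h1
      have h2 : ((d : ℕ) : ℤ) ∣ (q (N + n) : ℤ) ^ k := by exact_mod_cast hd
      have h3 : IsCoprime (p (N + n) ^ (k - 1 + 1)) ((q (N + n) : ℤ) ^ k) :=
        (c.isCoprime (N + n)).pow
      have h4 := h3.isUnit_of_dvd' h1 h2
      simpa using Int.isUnit_iff_natAbs_eq.1 h4

theorem eq_of_frac_eq {a : ℤ} {b n : ℕ} (hb : 0 < b) (hab : IsCoprime a b)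
    (h : (a : ℝ) / b = p n / q n) : b = q n := by
  have hq := c.q_pos n
  have hbR : (0 : ℝ) < b := by positivity
  rw [div_eq_div_iff hbR.ne' hq.ne'] at h
  have h' : a * q n = p n * b := by exact_mod_cast h
  have h1 : (b : ℤ) ∣ q n := hab.symm.dvd_of_dvd_mul_left ⟨p n, by linarith⟩
  have h2 : (q n : ℤ) ∣ b := (c.isCoprime n).symm.dvd_of_dvd_mul_left ⟨a, by linarith⟩
  exact Nat.dvd_antisymm (by exact_mod_cast h1) (by exact_mod_cast h2)

theorem not_solution_of_large {d R β : ℝ} {X : ℕ} (hΨ : Positive Ψ) (hR : |limit p q| < R)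
    (hd : 0 < d) (hd2 : d ≤ 1 / 2) (hdR : d * (1 + 2 * R) ≤ 1) (hX : DecaysFrom X d Ψ)
    (hβ : β < 1) : ∃ N₀, ∀ v ∈ solutions k (fun x => β * Ψ x) (limit p q), N₀ ≤ v.1 →
      ¬ (IsRelPrime v ∨ SubHomogeneous Ψ) := by
  have hk := c.two_le_k
  obtain ⟨n₀, hn₀⟩ := c.eventually_lt_abs_pow_sub hβ
  obtain ⟨N₀, hN₀⟩ := exists_eq_mul_pow hk c.irrational_limit hR hd hdR hX
    (max (max 3 X) (max (q 0) (q n₀)))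
  refine ⟨N₀, fun v hv hN hor => ?_⟩
  obtain ⟨hv1, hv2⟩ := hv
  have hΨv := hΨ v.1 hv1
  have hβ0 : 0 ≤ β := by
    by_contra hc
    have h1 := (abs_nonneg _).trans (hv2 ⟨0, by omega⟩)
    have h2 := mul_neg_of_neg_of_pos (not_le.1 hc) hΨv
    linarith
  obtain ⟨a, b, l, hB, hab, hNl, hP⟩ := hN₀ v.1 v.2 hN fun j => (hv2 j).trans (by nlinarith)
  have hb3 : 3 ≤ b := ((le_max_left _ _).trans (le_max_left _ _)).trans hB
  have hbX : X ≤ b := ((le_max_right _ _).trans (le_max_left _ _)).trans hB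
  have hbq0 : q 0 ≤ b := ((le_max_left _ _).trans (le_max_right _ _)).trans hB
  have hbq : q n₀ ≤ b := ((le_max_right _ _).trans (le_max_right _ _)).trans hB
  have hbpos : 0 < b := by omega
  have hbR : (3 : ℝ) ≤ b := by exact_mod_cast hb3
  have hbk : 1 ≤ b ^ k := Nat.one_le_pow _ _ hbpos
  have hl : 1 ≤ l := by
    rcases Nat.eq_zero_or_pos l with rfl | h
    · omega
    · exact h
  have hlR : (1 : ℝ) ≤ l := by exact_mod_cast hl
  -- Here the two versions part: for relatively prime vectors the common factor l is 1, otherwise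
  -- condition (B) is applied.
  have hΨl : Ψ v.1 ≤ l * Ψ (b ^ k) := by
    rcases hor with hrel | hB
    · have hl1 : l = 1 := by
        refine hrel l ⟨b ^ k, hNl⟩ fun j => ?_
        have e : (b : ℤ) ^ k = b ^ ((j : ℕ) + 1) * b ^ (k - 1 - j) := by
          rw [← pow_add]
          congr 1
          have := j.2
          omega
        refine ⟨a ^ ((j : ℕ) + 1) * b ^ (k - 1 - j), ?_⟩
        have hne : (b : ℤ) ^ ((j : ℕ) + 1) ≠ 0 := pow_ne_zero _ (by omega)
        refine mul_right_cancel₀ hne ?_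
        rw [hP j, hNl]
        push_cast
        rw [e]
        ring
      rw [hNl, hl1]
      simp
    · rw [hNl]
      exact hB l (b ^ k) hl hbk
  have hx : ∀ j < k, |limit p q ^ (j + 1) - ((a : ℝ) / b) ^ (j + 1)| ≤
      β * (Ψ (b ^ k) / (b : ℝ) ^ k) := by
    intro j hj
    have h1 := hv2 ⟨j, hj⟩
    have hNR : (v.1 : ℝ) = l * (b : ℝ) ^ k := by exact_mod_cast hNl
    have hPR : (v.2 ⟨j, hj⟩ : ℝ) = v.1 * ((a : ℝ) / b) ^ (j + 1) := by
      have h2 : (v.2 ⟨j, hj⟩ : ℝ) * (b : ℝ) ^ (j + 1) = v.1 * (a : ℝ) ^ (j + 1) := by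
        exact_mod_cast hP ⟨j, hj⟩
      rw [div_pow, mul_div_assoc', eq_div_iff (by positivity), h2]
    simp only at h1
    rw [hPR, mul_comm, ← mul_sub, abs_mul, Nat.abs_cast, hNR] at h1
    have h3 : β * Ψ v.1 ≤ β * (l * Ψ (b ^ k)) := by gcongr
    have h4 := h1.trans h3
    rw [mul_div_assoc', le_div_iff₀ (by positivity)]
    have h5 : l * (|limit p q ^ (j + 1) - ((a : ℝ) / b) ^ (j + 1)| * (b : ℝ) ^ k) ≤
        l * (β * Ψ (b ^ k)) := by linarith
    exact le_of_mul_le_mul_left h5 (by linarith)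
  -- Otherwise ζ would be at least 1 / (8 b^2) away from a / b, although the solution gives a
  -- distance below 1 / (2 b^4), and b ≥ 3.
  have hex : ∃ n, (a : ℝ) / b = p n / q n := by
    by_contra! hne
    have h1 := c.one_div_le_abs_limit_sub hbq0 hne
    have h2 := hx 0 (by omega)
    rw [zero_add, pow_one, pow_one] at h2
    have h3 := hX (b ^ k) hbk (hbX.trans (Nat.le_self_pow (by omega) _))
    push_cast at h3
    have h4 : (b : ℝ) ^ 2 ≤ b ^ k := pow_le_pow_right₀ (by linarith) hk
    have h5 : Ψ (b ^ k) / (b : ℝ) ^ k ≤ 1 / 2 / b ^ 2 / b ^ 2 := by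
      have : Ψ (b ^ k) ≤ 1 / 2 / (b : ℝ) ^ 2 := h3.le.trans (by gcongr)
      gcongr
    have h6 : 0 < Ψ (b ^ k) / (b : ℝ) ^ k := by
      have := hΨ _ hbk
      positivity
    have h7 : 1 / 2 / (b : ℝ) ^ 2 / b ^ 2 < 1 / (8 * b ^ 2) := by
      rw [div_div, div_div, div_lt_div_iff₀ (by positivity) (by positivity)]
      have h9 : 9 ≤ (b : ℝ) ^ 2 := by nlinarith
      nlinarith
    nlinarith
  obtain ⟨n, hn⟩ := hex
  have hbn := c.eq_of_frac_eq hbpos hab hn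
  obtain ⟨j, hj, hlt⟩ := hn₀ n (c.q_strictMono.le_iff_le.1 (hbn ▸ hbq))
  have h1 := hx j hj
  rw [hn, hbn] at h1
  linarith

theorem limit_mem {d R : ℝ} {X : ℕ} (hΨ : Positive Ψ) (hR : |limit p q| < R)
    (hd : 0 < d) (hd2 : d ≤ 1 / 2) (hdR : d * (1 + 2 * R) ≤ 1) (hX : DecaysFrom X d Ψ) :
    (SubHomogeneous Ψ →
      limit p q ∈ K k Ψ \ ⋃ (b : ℝ) (_ : b < 1), K k (fun x => b * Ψ x)) ∧
    limit p q ∈ KStar k Ψ \ ⋃ (b : ℝ) (_ : b < 1), KStar k (fun x => b * Ψ x) := by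
  have hinf := c.infinite_solutions
  refine ⟨fun hB => ⟨⟨c.limit_mem_nonAlgebraic, hinf.mono fun v hv => hv.1⟩, ?_⟩,
    ⟨c.limit_mem_nonAlgebraic, hinf⟩, ?_⟩
  · simp only [Set.mem_iUnion, not_exists]
    rintro b hb ⟨-, h⟩
    obtain ⟨N₀, hN₀⟩ := c.not_solution_of_large hΨ hR hd hd2 hdR hX hb
    obtain ⟨v, hv, hN⟩ := exists_large_of_infinite Subset.rfl h N₀
    exact hN₀ v hv hN (Or.inr hB)
  · simp only [Set.mem_iUnion, not_exists]
    rintro b hb ⟨-, h⟩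
    obtain ⟨N₀, hN₀⟩ := c.not_solution_of_large hΨ hR hd hd2 hdR hX hb
    obtain ⟨v, hv, hN⟩ := exists_large_of_infinite (fun v hv => hv.1) h N₀
    exact hN₀ v hv.1 hN (Or.inl hv.2)

end Chain

/-! ### Uncountability, computed elements and the effective constant -/

theorem exists_isFunName {Ψ : ℕ → ℝ} (hΨ : Positive Ψ) : ∃ f, IsFunName f Ψ := by
  refine ⟨fun i => ⌊Ψ i.unpair.1 * 2 ^ i.unpair.2⌋₊, fun x hx n => ?_⟩
  have hM : (0 : ℝ) < 2 ^ n := by positivity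
  have h0 : 0 ≤ Ψ x * 2 ^ n := mul_nonneg (hΨ x hx).le hM.le
  have h1 := Nat.floor_le h0
  have h2 := Nat.lt_floor_add_one (Ψ x * 2 ^ n)
  simp only [Nat.unpair_pair]
  have e : Ψ x - (⌊Ψ x * 2 ^ n⌋₊ : ℝ) / 2 ^ n = (Ψ x * 2 ^ n - ⌊Ψ x * 2 ^ n⌋₊) / 2 ^ n := by
    field_simp
  rw [e, abs_div, abs_of_pos hM, abs_of_nonneg (by linarith)]
  gcongr
  linarith

theorem exists_ratInterval_subset {I : Set ℝ} (hI : IsOpenInterval I) :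
    ∃ (u v : ℤ) (w : ℕ), 0 < w ∧ u < v ∧ ratInterval u v w ⊆ I := by
  obtain ⟨hopen, -, x, hx⟩ := hI
  obtain ⟨l, r, hxlr, hlr⟩ := mem_nhds_iff_exists_Ioo_subset.1 (hopen.mem_nhds hx)
  obtain ⟨a, ha1, ha2⟩ := exists_rat_btwn (hxlr.1.trans hxlr.2)
  obtain ⟨b, hb1, hb2⟩ := exists_rat_btwn ha2
  have hab : a < b := by exact_mod_cast hb1
  have hda := a.den_pos
  have hdb := b.den_pos
  have ea : ((a.num * b.den : ℤ) : ℝ) / ((a.den * b.den : ℕ) : ℝ) = a := by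
    rw [Rat.cast_def a]
    push_cast
    field_simp
  have eb : ((b.num * a.den : ℤ) : ℝ) / ((a.den * b.den : ℕ) : ℝ) = b := by
    rw [Rat.cast_def b]
    push_cast
    field_simp
  refine ⟨a.num * b.den, b.num * a.den, a.den * b.den, by positivity, ?_, ?_⟩
  · exact Rat.lt_iff a b |>.1 hab
  · rw [ratInterval, ea, eb]
    exact (Ioo_subset_Ioo ha1.le hb2.le).trans hlr

/-- The exact approximation sets are uncountable in every rational interval. -/
theorem not_countable_of_decaysFrom {k X : ℕ} {u v : ℤ} {w : ℕ} {Ψ : ℕ → ℝ} {d R : ℝ}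
    (hk : 2 ≤ k) (hw : 0 < w) (huv : u < v) (hΨ : Positive Ψ) (hd : 0 < d) (hd2 : d ≤ 1 / 2)
    (hdR : d * (1 + 2 * R) ≤ 1) (hX : DecaysFrom X d Ψ)
    (hR : ∀ ζ ∈ ratInterval u v w, |ζ| < R) :
    (SubHomogeneous Ψ → ¬ ((K k Ψ \ ⋃ (b : ℝ) (_ : b < 1), K k (fun x => b * Ψ x)) ∩
      ratInterval u v w).Countable) ∧
    ¬ ((KStar k Ψ \ ⋃ (b : ℝ) (_ : b < 1), KStar k (fun x => b * Ψ x)) ∩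
      ratInterval u v w).Countable := by
  obtain ⟨f, hf⟩ := exists_isFunName hΨ
  have hc : ∀ e : ℕ → Bool, Chain k Ψ
      (fun n => (orbit k X u w f (fun n => (e n).toNat) n).2.1)
      fun n => (orbit k X u w f (fun n => (e n).toNat) n).2.2 := fun e =>
    chain_orbit hk hw hΨ hd2 hX hf fun n => Bool.toNat_le (e n)
  obtain ⟨z, hz⟩ : ∃ z : (ℕ → Bool) → ℝ, ∀ e, z e = limit
    (fun n => (orbit k X u w f (fun n => (e n).toNat) n).2.1)
    (fun n => (orbit k X u w f (fun n => (e n).toNat) n).2.2) := ⟨_, fun _ => rfl⟩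
  have hmem : ∀ e, z e ∈ ratInterval u v w := fun e => hz e ▸ limit_orbit_mem hw huv (hc e)
  have hK := fun e => (hc e).limit_mem hΨ (hz e ▸ hR _ (hmem e)) hd hd2 hdR hX
  simp only [← hz] at hK
  -- Two binary sequences are compared at their first difference, where `limit_orbit_lt` separates
  -- the limits.
  have hinj : Function.Injective z := by
    intro e e' h
    by_contra hne
    have hex : ∃ n, e n ≠ e' n := Function.ne_iff.1 hne
    classical
    have hlt : ∀ m < Nat.find hex, e m = e' m := fun m hm => not_not.1 (Nat.find_min hex hm)
    have hn := Nat.find_spec hex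
    have hn' : (e (Nat.find hex)).toNat ≠ (e' (Nat.find hex)).toNat := by
      intro h0
      apply hn
      revert h0
      cases e (Nat.find hex) <;> cases e' (Nat.find hex) <;> simp
    rw [hz, hz] at h
    rcases Nat.lt_or_gt_of_ne hn' with h1 | h1
    · exact (limit_orbit_lt (e := fun n => (e n).toNat) (e' := fun n => (e' n).toNat) hw
        (fun m hm => congrArg Bool.toNat (hlt m hm)) h1 (hc e) (hc e')).ne' h
    · exact (limit_orbit_lt (e := fun n => (e' n).toNat) (e' := fun n => (e n).toNat) hw
        (fun m hm => congrArg Bool.toNat (hlt m hm).symm) h1 (hc e') (hc e)).ne h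
  have key : ∀ S : Set ℝ, (∀ e, z e ∈ S) → ¬ S.Countable := by
    intro S hS hcount
    have h1 : (range z).Countable := hcount.mono (range_subset_iff.2 hS)
    have : Countable (ℕ → Bool) := by
      rw [← Set.countable_univ_iff]
      rw [← image_univ] at h1
      exact (Set.countable_of_injective_of_countable_image hinj.injOn h1)
    have h2 : Cardinal.mk (ℕ → Bool) ≤ Cardinal.aleph0 := Cardinal.mk_le_aleph0
    simp only [Cardinal.mk_pi, Cardinal.prod_const, Cardinal.mk_bool, Cardinal.mk_nat,
      Cardinal.lift_id] at h2
    exact absurd h2 (not_le.2 (Cardinal.cantor _))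
  exact ⟨fun hB => key _ fun e => ⟨(hK e).1 hB, hmem e⟩, key _ fun e => ⟨(hK e).2, hmem e⟩⟩

theorem exists_computed_mem {k X : ℕ} {u v : ℤ} {w : ℕ} {Ψ : ℕ → ℝ} {d R : ℝ}
    (hk : 2 ≤ k) (hw : 0 < w) (huv : u < v) (hΨ : Positive Ψ) (hd : 0 < d) (hd2 : d ≤ 1 / 2)
    (hdR : d * (1 + 2 * R) ≤ 1) (hX : DecaysFrom X d Ψ)
    (hR : ∀ ζ ∈ ratInterval u v w, |ζ| < R) {f : ℕ → ℕ} (hf : IsFunName f Ψ) :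
    ∃ (ζ : ℝ) (g : ℕ → ℤ), IsRealName g ζ ∧ OracleComputes algorithm f (k, X, u, v, w) g ∧
      ζ ∈ ratInterval u v w ∧
      (SubHomogeneous Ψ → ζ ∈ K k Ψ \ ⋃ (b : ℝ) (_ : b < 1), K k (fun x => b * Ψ x)) ∧
      ζ ∈ KStar k Ψ \ ⋃ (b : ℝ) (_ : b < 1), KStar k (fun x => b * Ψ x) := by
  have c := chain_orbit (u := u) (e := fun _ => 0) hk hw hΨ hd2 hX hf fun _ => zero_le_one
  have hmem := limit_orbit_mem hw huv c
  exact ⟨_, _, isRealName_orbit c, oracleComputes_algorithm v hw hΨ hf, hmem,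
    c.limit_mem hΨ (hR _ hmem) hd hd2 hdR hX⟩

theorem abs_lt_of_mem_ratInterval {u v : ℤ} {w : ℕ} (hw : 0 < w) {ζ : ℝ}
    (h : ζ ∈ ratInterval u v w) : |ζ| < (u.natAbs + v.natAbs : ℕ) := by
  obtain ⟨h1, h2⟩ := h
  have hwR : (1 : ℝ) ≤ w := by exact_mod_cast hw
  have key : ∀ x : ℤ, |(x : ℝ) / w| ≤ x.natAbs := by
    intro x
    rw [abs_div, Nat.abs_cast, Nat.cast_natAbs, Int.cast_abs]
    exact div_le_self (abs_nonneg _) hwR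
  have hu := abs_le.1 (key u)
  have hv := abs_le.1 (key v)
  have hu0 : (0 : ℝ) ≤ u.natAbs := by positivity
  have hv0 : (0 : ℝ) ≤ v.natAbs := by positivity
  rw [abs_lt]
  push_cast at *
  constructor <;> linarith

/-- The reciprocal of the effective constant. -/
def effectiveBound (x : ℤ × ℤ × ℕ) : ℕ := 2 * (x.1.natAbs + x.2.1.natAbs) + 1

theorem primrec_effectiveBound : Primrec effectiveBound :=
  Primrec.succ.comp (Primrec.nat_mul.comp (Primrec.const 2) (Primrec.nat_add.comp
    (primrec_int_natAbs.comp Primrec.fst)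
    (primrec_int_natAbs.comp (Primrec.fst.comp Primrec.snd))))

/-- With R = |u| + |v| the constant 1 / (1 + 2 R) is what the square requires. It is at most 1 / 2
because u < v excludes R = 0. -/
theorem effectiveBound_spec {u v : ℤ} (w : ℕ) (huv : u < v) :
    0 < 1 / (effectiveBound (u, v, w) : ℝ) ∧ 1 / (effectiveBound (u, v, w) : ℝ) ≤ 1 / 2 ∧
      1 / (effectiveBound (u, v, w) : ℝ) * (1 + 2 * (u.natAbs + v.natAbs : ℕ)) ≤ 1 := by
  have h2 : (2 : ℝ) ≤ effectiveBound (u, v, w) := by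
    have : 2 ≤ effectiveBound (u, v, w) := by
      simp only [effectiveBound]
      omega
    exact_mod_cast this
  refine ⟨by positivity, one_div_le_one_div_of_le two_pos h2, ?_⟩
  rw [one_div_mul_eq_div, div_le_one (by linarith)]
  simp only [effectiveBound]
  push_cast
  linarith

end PowerApprox

theorem theorem5 :
    -- the first claim
    (∀ (k : ℕ), 2 ≤ k → ∀ (Ψ : ℕ → ℝ), PowerApprox.Positive Ψ →
      (∃ X : ℕ, PowerApprox.DecaysFrom X (1 / 2) Ψ) →
      ∀ I : Set ℝ, PowerApprox.IsOpenInterval I → I ⊆ Set.Ioo (-1 / 2 : ℝ) (1 / 2) →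
        (PowerApprox.SubHomogeneous Ψ →
          ¬ ((PowerApprox.K k Ψ \ ⋃ (c : ℝ) (_ : c < 1),
              PowerApprox.K k (fun x => c * Ψ x)) ∩ I).Countable) ∧
        ¬ ((PowerApprox.KStar k Ψ \ ⋃ (c : ℝ) (_ : c < 1),
            PowerApprox.KStar k (fun x => c * Ψ x)) ∩ I).Countable) ∧
    -- the elements in the first claim can be determined effectively, by one algorithm
    (∃ M : List ℕ × (ℕ × ℕ × ℤ × ℤ × ℕ) × ℕ → Option ℤ, Computable M ∧
      ∀ (k X : ℕ) (u v : ℤ) (w : ℕ), 2 ≤ k → 0 < w → u < v →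
        PowerApprox.ratInterval u v w ⊆ Set.Ioo (-1 / 2 : ℝ) (1 / 2) →
        ∀ (Ψ : ℕ → ℝ), PowerApprox.Positive Ψ → PowerApprox.DecaysFrom X (1 / 2) Ψ →
        ∀ f : ℕ → ℕ, PowerApprox.IsFunName f Ψ →
          ∃ (ζ : ℝ) (g : ℕ → ℤ), PowerApprox.IsRealName g ζ ∧
            PowerApprox.OracleComputes M f (k, X, u, v, w) g ∧
            ζ ∈ PowerApprox.ratInterval u v w ∧
            (PowerApprox.SubHomogeneous Ψ →
              ζ ∈ PowerApprox.K k Ψ \ ⋃ (c : ℝ) (_ : c < 1),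
                PowerApprox.K k (fun x => c * Ψ x)) ∧
            ζ ∈ PowerApprox.KStar k Ψ \ ⋃ (c : ℝ) (_ : c < 1),
              PowerApprox.KStar k (fun x => c * Ψ x)) ∧
    -- the effective constant `d = 1 / D (u, v, w)` of the second claim; it depends only on a
    -- rational interval `(u / w, v / w)` inside `J`, hence on `J` alone
    (∃ D : ℤ × ℤ × ℕ → ℕ, Computable D ∧ (∀ e, 0 < D e) ∧
      -- the second claim
      (∀ J : Set ℝ, PowerApprox.IsOpenInterval J →
        ∀ (u v : ℤ) (w : ℕ), 0 < w → u < v → PowerApprox.ratInterval u v w ⊆ J →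
        ∀ (k : ℕ), 2 ≤ k → ∀ (Ψ : ℕ → ℝ), PowerApprox.Positive Ψ →
        (∃ X : ℕ, PowerApprox.DecaysFrom X (1 / (D (u, v, w) : ℝ)) Ψ) →
        ∀ c₀ : ℝ, c₀ < 1 →
          (PowerApprox.SubHomogeneous Ψ →
            ¬ ((PowerApprox.K k Ψ \ PowerApprox.K k (fun x => c₀ * Ψ x)) ∩ J).Countable) ∧
          ¬ ((PowerApprox.KStar k Ψ \
              PowerApprox.KStar k (fun x => c₀ * Ψ x)) ∩ J).Countable) ∧
      -- the elements in the second claim can be determined effectively, by one algorithm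
      -- (for the rational constant `c₀ = s / t`)
      (∃ M : List ℕ × (ℕ × ℕ × ℤ × ℤ × ℕ × ℕ × ℕ) × ℕ → Option ℤ, Computable M ∧
        ∀ (k X : ℕ) (u v : ℤ) (w s t : ℕ), 2 ≤ k → 0 < w → u < v → s < t →
          ∀ (Ψ : ℕ → ℝ), PowerApprox.Positive Ψ →
          PowerApprox.DecaysFrom X (1 / (D (u, v, w) : ℝ)) Ψ →
          ∀ f : ℕ → ℕ, PowerApprox.IsFunName f Ψ →
            ∃ (ζ : ℝ) (g : ℕ → ℤ), PowerApprox.IsRealName g ζ ∧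
              PowerApprox.OracleComputes M f (k, X, u, v, w, s, t) g ∧
              ζ ∈ PowerApprox.ratInterval u v w ∧
              (PowerApprox.SubHomogeneous Ψ →
                ζ ∈ PowerApprox.K k Ψ \
                  PowerApprox.K k (fun x => (s : ℝ) / (t : ℝ) * Ψ x)) ∧
              ζ ∈ PowerApprox.KStar k Ψ \
                PowerApprox.KStar k (fun x => (s : ℝ) / (t : ℝ) * Ψ x))) := by
  have hhalf : ∀ {u v : ℤ} {w : ℕ},
      PowerApprox.ratInterval u v w ⊆ Set.Ioo (-1 / 2 : ℝ) (1 / 2) →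
      ∀ ζ ∈ PowerApprox.ratInterval u v w, |ζ| < 1 / 2 := fun h ζ hζ => by
    obtain ⟨h1, h2⟩ := h hζ
    exact abs_lt.2 ⟨by linarith, h2⟩
  refine ⟨?_, ⟨_, PowerApprox.primrec_algorithm.to_comp, ?_⟩, PowerApprox.effectiveBound,
    PowerApprox.primrec_effectiveBound.to_comp, fun e => Nat.succ_pos _, ?_,
    fun x => PowerApprox.algorithm
      (x.1, (x.2.1.1, x.2.1.2.1, x.2.1.2.2.1, x.2.1.2.2.2.1, x.2.1.2.2.2.2.1), x.2.2), ?_, ?_⟩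
  · rintro k hk Ψ hΨ ⟨X, hX⟩ I hI hsub
    obtain ⟨u, v, w, hw, huv, hI'⟩ := PowerApprox.exists_ratInterval_subset hI
    -- With d = R = 1 / 2 the condition d (1 + 2 R) ≤ 1 holds with equality, which explains the
    -- interval (-1/2, 1/2).
    obtain ⟨h1, h2⟩ := PowerApprox.not_countable_of_decaysFrom hk hw huv hΨ (by norm_num)
      le_rfl (by norm_num) hX (hhalf (hI'.trans hsub))
    exact ⟨fun hB h => h1 hB (h.mono (inter_subset_inter_right _ hI')),
      fun h => h2 (h.mono (inter_subset_inter_right _ hI'))⟩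
  · intro k X u v w hk hw huv hsub Ψ hΨ hX f hf
    exact PowerApprox.exists_computed_mem hk hw huv hΨ (by norm_num) le_rfl (by norm_num) hX
      (hhalf hsub) hf
  · rintro J - u v w hw huv hJ k hk Ψ hΨ ⟨X, hX⟩ c₀ hc₀
    obtain ⟨hd, hd2, hdR⟩ := PowerApprox.effectiveBound_spec w huv
    obtain ⟨h1, h2⟩ := PowerApprox.not_countable_of_decaysFrom hk hw huv hΨ hd hd2 hdR hX
      fun ζ => PowerApprox.abs_lt_of_mem_ratInterval hw
    -- Removing the sets for all c < 1 removes in particular the one for c₀.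
    refine ⟨fun hB h => h1 hB (h.mono (inter_subset_inter ?_ hJ)),
      fun h => h2 (h.mono (inter_subset_inter ?_ hJ))⟩
    · exact sdiff_subset_sdiff_right (subset_biUnion_of_mem (s := Iio 1)
        (u := fun c : ℝ => PowerApprox.K k fun x => c * Ψ x) hc₀)
    · exact sdiff_subset_sdiff_right (subset_biUnion_of_mem (s := Iio 1)
        (u := fun c : ℝ => PowerApprox.KStar k fun x => c * Ψ x) hc₀)
  · refine (PowerApprox.primrec_algorithm.comp ?_).to_comp
    have hi : Primrec fun x : List ℕ × (ℕ × ℕ × ℤ × ℤ × ℕ × ℕ × ℕ) × ℕ => x.2.1 :=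
      Primrec.fst.comp Primrec.snd
    have h1 := Primrec.snd.comp hi
    have h2 := Primrec.snd.comp h1
    have h3 := Primrec.snd.comp h2
    have h4 := Primrec.snd.comp h3
    exact Primrec.pair Primrec.fst (Primrec.pair (Primrec.pair (Primrec.fst.comp hi)
      (Primrec.pair (Primrec.fst.comp h1) (Primrec.pair (Primrec.fst.comp h2)
        (Primrec.pair (Primrec.fst.comp h3) (Primrec.fst.comp h4)))))
      (Primrec.snd.comp Primrec.snd))
  · intro k X u v w s t hk hw huv hst Ψ hΨ hX f hf
    obtain ⟨hd, hd2, hdR⟩ := PowerApprox.effectiveBound_spec w huv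
    obtain ⟨ζ, g, hg, hM, hmem, h1, h2⟩ := PowerApprox.exists_computed_mem hk hw huv hΨ hd hd2
      hdR hX (fun ζ => PowerApprox.abs_lt_of_mem_ratInterval hw) hf
    have hc₀ : (s : ℝ) / t < 1 := by
      have : (s : ℝ) < t := by exact_mod_cast hst
      rw [div_lt_one (by linarith [(Nat.cast_nonneg s : (0 : ℝ) ≤ s)])]
      exact this
    refine ⟨ζ, g, hg, hM, hmem, fun hB => ?_, ?_⟩
    · exact sdiff_subset_sdiff_right (subset_biUnion_of_mem (s := Iio 1)
        (u := fun c : ℝ => PowerApprox.K k fun x => c * Ψ x) hc₀) (h1 hB)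
    · exact sdiff_subset_sdiff_right (subset_biUnion_of_mem (s := Iio 1)
        (u := fun c : ℝ => PowerApprox.KStar k fun x => c * Ψ x) hc₀) h2
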